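/- Let $X$ be a real random variable with $\mathbb{E}[X]=0$, $\mathbb{E}[X^2]=1$ and $\mathbb{E}[X^4]<\infty$, and let $(p_n)_{n\ge 1}$ be a sequence of positive integers with $p_n\to\infty$ as $n\to\infty$ (at an arbitrary rate). For each $n\ge 1$ let $\mathbf{x}_1,\dots,\mathbf{x}_n$ be a sample of $p$-dimensional random vectors, $p=p_n$, whose $np$ components are independent copies of $X$, and let $$\mathbf{S}=\mathbf{S}_n=\frac1n\sum_{t=1}^n \mathbf{x}_t\mathbf{x}_t^\top$$ be the $p\times p$ sample covariance matrix. Put $$\mu_n=\frac pn\bigl(n+\mathbb{E}[X^4]-2\bigr)+\frac{p^2}{n},\qquad \sigma_n^2=\Bigl(\frac pn+2\frac{p^2}{n^2}+\frac{p^3}{n^3}\Bigr)\,4\bigl(\mathbb{E}[X^4]-1\bigr)+4\frac{p^2}{n^2},\qquad \sigma_n\ge 0.$$ Then $\mathbb{E}[\operatorname{tr}(\mathbf{S}_n^2)]=\mu_n$ for every $n\ge 1$, and, as $n\to\infty$, $$\frac{\operatorname{tr}(\mathbf{S}_n^2)-\mu_n}{\sigma_n}\ \xrightarrow{\ d\ }\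 Z$$ for a standard normal random variable $Z$. -/

import Mathlib

open MeasureTheory ProbabilityTheory Filter

/-- The (uncentred) sample covariance matrix `S = (1/n) ∑ₜ xₜ xₜᵀ` of the observations
`x₁, …, xₙ ∈ ℝᵖ`. -/
noncomputable def sampleCov {n p : ℕ} (x : Fin n → Fin p → ℝ) : Matrix (Fin p) (Fin p) ℝ :=
  (1 / (n : ℝ)) • ∑ t, Matrix.vecMulVec (x t) (x t)

/-- The squared Frobenius norm `tr(S²)` of the sample covariance matrix. -/
noncomputable def trSq {n p : ℕ} (x : Fin n → Fin p → ℝ) : ℝ :=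
  Matrix.trace (sampleCov x ^ 2)

/-- The centring `(p/n)(n + m₄ - 2) + p²/n`, where `m₄` stands for the fourth moment. -/
noncomputable def muCLT (n p : ℕ) (m₄ : ℝ) : ℝ :=
  (p : ℝ) / n * ((n : ℝ) + m₄ - 2) + (p : ℝ) ^ 2 / n

/-- The squared scaling `(p/n + 2p²/n² + p³/n³) · 4(m₄ - 1) + 4p²/n²`. -/
noncomputable def sigmaSqCLT (n p : ℕ) (m₄ : ℝ) : ℝ :=
  ((p : ℝ) / n + 2 * ((p : ℝ) ^ 2 / (n : ℝ) ^ 2) + (p : ℝ) ^ 3 / (n : ℝ) ^ 3)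
      * (4 * (m₄ - 1)) + 4 * ((p : ℝ) ^ 2 / (n : ℝ) ^ 2)

/-- The scaling, the nonnegative square root of `sigmaSqCLT`. -/
noncomputable def sigmaCLT (n p : ℕ) (m₄ : ℝ) : ℝ :=
  Real.sqrt (sigmaSqCLT n p m₄)

/-!
Write `y = x² - 1`, `κ = E y² = E X⁴ - 1` and `s = n² σₙ`. Expanding `tr S²` over the entries gives
(`trSq_sub_muCLT`)

`n² (tr S² - μₙ) = 2 (n + p - 2) ∑ y(x_{ti}) + U + R`,

where `U` is the sum of `x_{si} x_{sj} x_{ti} x_{tj}` over `s ≠ t`, `i ≠ j` (`crossSum`), and `R`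
collects `∑ (x_{ti}⁴ - E X⁴)` and the pair sums of `y` within one observation (`colPairs`) and
within one coordinate (`rowPairs`). All terms are centred, which gives the mean. The first two terms
are uncorrelated, with total variance asymptotic to `s² = 4κ np(n + p)² + 4n²p²`. Since `s ≥ 2np`,
the term `R / s` tends to `0` in `L¹` as `n, p → ∞`: the pair sums by their second moments, and the
sum of fourth powers, which need not have a variance, by a weak law of large numbers. So does the
error of replacing `n + p - 2` by `n + p`, and replacing `y` by a centred `g ∈ L⁴` close to `y` in
`L²` costs an arbitrarily small amount (`integral_abs_stat_sub_mart_le`).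

What remains, `α ∑ g(x_{ti}) + β U` with `α = 2(n + p)/s` and `β = 1/s`, is a martingale in the
number of observations (`mart`). Given the earlier observations, its increment is a linear form plus
a quadratic form whose matrix is the off-diagonal Gram matrix of those observations; its conditional
variance is `α² p E g² + 8 β² N`, with `N` the sum of the squared off-diagonal Gram entries. Because
each `N` is within `O(np + √(n p³))` of its mean in `L²` (`integral_gramSq_sub_sq_le`), the
conditional variances are close to constants individually, and the characteristic function
is multiplied by about `exp (-u² v / 2)` at each step, with deterministic `v`
(`norm_charFun_mart_succ_sub_le`). No stopping time or conditional expectation is needed: everything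
takes place on the product space, by induction on the number of observations and Fubini's theorem.
The third-order remainder is controlled by fourth moments, where the quadratic form is handled by a
reverse Hölder inequality (`integral_quadForm_pow_four_le`). Lévy's continuity theorem concludes.
-/

/-! ### Product spaces: appending one observation -/

/-- The law of `n` independent observations with common law `ν`. -/
noncomputable abbrev iidLaw {E : Type*} [MeasurableSpace E] (ν : Measure E) (n : ℕ) :
    Measure (Fin n → E) :=
  Measure.pi fun _ => ν

/-- Appending one more observation, as a measurable equivalence. -/
def snocEquiv (E : Type*) [MeasurableSpace E] (n : ℕ) :
    ((Fin n → E) × E) ≃ᵐ (Fin (n + 1) → E) :=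
  MeasurableEquiv.prodComm.trans (MeasurableEquiv.piFinSuccAbove (fun _ => E) (Fin.last n)).symm

section Product

variable {E : Type*} [MeasurableSpace E] {ν : Measure E} [IsProbabilityMeasure ν]
  {Z : Type*} [MeasurableSpace Z] {ρ : Measure Z}

lemma snocEquiv_apply (n : ℕ) (q : (Fin n → E) × E) :
    snocEquiv E n q = (Fin.snoc q.1 q.2 : Fin (n + 1) → E) := by
  ext i
  refine Fin.lastCases ?_ (fun j => ?_) i <;> simp [snocEquiv, MeasurableEquiv.prodComm]

lemma measurePreserving_snocEquiv (n : ℕ) :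
    MeasurePreserving (snocEquiv E n) ((iidLaw ν n).prod ν) (iidLaw ν (n + 1)) :=
  ((measurePreserving_piFinSuccAbove (fun _ => ν) (Fin.last n)).symm).comp
    Measure.measurePreserving_swap

lemma integral_iidLaw_succ {F : Type*} [NormedAddCommGroup F] [NormedSpace ℝ F] (n : ℕ)
    (f : (Fin (n + 1) → E) → F) :
    ∫ z, f z ∂(iidLaw ν (n + 1)) =
      ∫ q, f (Fin.snoc q.1 q.2 : Fin (n + 1) → E) ∂((iidLaw ν n).prod ν) := by
  rw [← (measurePreserving_snocEquiv n).integral_comp (snocEquiv E n).measurableEmbedding]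
  simp_rw [snocEquiv_apply]

lemma MeasureTheory.MemLp.comp_eval {f : E → ℝ} {r : ENNReal} (hf : MemLp f r ν) (n : ℕ) (i : Fin n) :
    MemLp (fun z : Fin n → E => f (z i)) r (iidLaw ν n) :=
  hf.comp_measurePreserving (measurePreserving_eval (fun _ => ν) i)

lemma MeasureTheory.MemLp.comp_prod_fst {f : Z → ℝ} {r : ENNReal} (hf : MemLp f r ρ) :
    MemLp (fun q : Z × E => f q.1) r (ρ.prod ν) :=
  hf.comp_measurePreserving measurePreserving_fst

lemma memLp_of_integrable_pow {f : Z → ℝ} (hf : AEStronglyMeasurable f ρ) {k : ℕ} (hk : k ≠ 0)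
    (h : Integrable (fun z => ‖f z‖ ^ k) ρ) : MemLp f k ρ := by
  rw [← integrable_norm_rpow_iff hf (by simpa using hk) (by simp)]
  simpa using h

lemma MeasureTheory.MemLp.integrable_pow_four {f : Z → ℝ} (hf : MemLp f 4 ρ) :
    Integrable (fun z => f z ^ 4) ρ := by
  have := hf.integrable_norm_pow (p := 4) (by norm_num)
  refine this.congr (ae_of_all _ fun z => ?_)
  simp only [Real.norm_eq_abs]
  exact (show Even 4 by decide).pow_abs _

lemma MeasureTheory.MemLp.sq_of_four {f : Z → ℝ} (hf : MemLp f 4 ρ) : MemLp (fun z => f z ^ 2) 2 ρ := by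
  refine (memLp_two_iff_integrable_sq (hf.1.pow 2)).2 ?_
  simpa [← pow_mul] using MemLp.integrable_pow_four hf

lemma memLp_four_of_integrable {f : Z → ℝ} (hf : AEStronglyMeasurable f ρ)
    (h : Integrable (fun z => f z ^ 4) ρ) : MemLp f 4 ρ := by
  refine memLp_of_integrable_pow (k := 4) hf (by norm_num) ?_
  refine h.congr (ae_of_all _ fun z => ?_)
  simp only [Real.norm_eq_abs]
  exact ((show Even 4 by decide).pow_abs _).symm

lemma integral_add_three {f g h : Z → ℝ} (hf : Integrable f ρ) (hg : Integrable g ρ)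
    (hh : Integrable h ρ) :
    ∫ z, (f z + g z + h z) ∂ρ = ∫ z, f z ∂ρ + ∫ z, g z ∂ρ + ∫ z, h z ∂ρ := by
  rw [← integral_add hf hg]
  exact integral_add (hf.add hg) hh

lemma integral_add_four {f g h k : Z → ℝ} (hf : Integrable f ρ) (hg : Integrable g ρ)
    (hh : Integrable h ρ) (hk : Integrable k ρ) :
    ∫ z, (f z + g z + h z + k z) ∂ρ =
      ∫ z, f z ∂ρ + ∫ z, g z ∂ρ + ∫ z, h z ∂ρ + ∫ z, k z ∂ρ := by
  rw [← integral_add_three hf hg hh]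
  exact integral_add ((hf.add hg).add hh) hk

/-- Cauchy–Schwarz. -/
lemma integral_mul_le_sqrt_mul_sqrt {f g : Z → ℝ} (hf : MemLp f 2 ρ) (hg : MemLp g 2 ρ) :
    ∫ z, f z * g z ∂ρ ≤ √(∫ z, f z ^ 2 ∂ρ) * √(∫ z, g z ^ 2 ∂ρ) := by
  have hfg : Integrable (fun z => f z * g z) ρ := hf.integrable_mul hg
  have key : ∀ t : ℝ, 0 ≤ (∫ z, f z ^ 2 ∂ρ) * (t * t) + (2 * ∫ z, f z * g z ∂ρ) * t
      + ∫ z, g z ^ 2 ∂ρ := by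
    intro t
    have : ∫ z, (t * f z + g z) ^ 2 ∂ρ = (∫ z, f z ^ 2 ∂ρ) * (t * t)
        + (2 * ∫ z, f z * g z ∂ρ) * t + ∫ z, g z ^ 2 ∂ρ := by
      have e : ∀ z, (t * f z + g z) ^ 2 = (t * t) * f z ^ 2 + (2 * t) * (f z * g z) + g z ^ 2 :=
        fun z => by ring
      simp_rw [e]
      rw [integral_add_three (hf.integrable_sq.const_mul _) (hfg.const_mul _) hg.integrable_sq,
        integral_const_mul, integral_const_mul]
      ring
    rw [← this]
    exact integral_nonneg fun z => sq_nonneg _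
  have hd := discrim_le_zero key
  rw [discrim] at hd
  rw [← Real.sqrt_mul (integral_nonneg fun z => sq_nonneg _)]
  exact Real.le_sqrt_of_sq_le (by nlinarith)

variable [IsProbabilityMeasure ρ]

lemma MeasureTheory.MemLp.comp_prod_snd {f : E → ℝ} {r : ENNReal} (hf : MemLp f r ν) :
    MemLp (fun q : Z × E => f q.2) r (ρ.prod ν) :=
  hf.comp_measurePreserving measurePreserving_snd

lemma MeasureTheory.MemLp.prod_mul {f : Z → ℝ} {g : E → ℝ} {k : ℕ} (hk : k ≠ 0) (hf : MemLp f k ρ)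
    (hg : MemLp g k ν) : MemLp (fun q : Z × E => f q.1 * g q.2) k (ρ.prod ν) := by
  refine memLp_of_integrable_pow ?_ hk ?_
  · exact (MemLp.comp_prod_fst hf).1.mul (MemLp.comp_prod_snd hg).1
  · simp_rw [norm_mul, mul_pow]
    exact (hf.integrable_norm_pow hk).mul_prod (hg.integrable_norm_pow hk)

lemma MeasureTheory.MemLp.two_of_four {f : Z → ℝ} (hf : MemLp f 4 ρ) : MemLp f 2 ρ :=
  hf.mono_exponent (by norm_num)

lemma MeasureTheory.MemLp.one_of_two {f : Z → ℝ} (hf : MemLp f 2 ρ) : Integrable f ρ :=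
  hf.integrable (by norm_num)

lemma integral_abs_le_sqrt {f : Z → ℝ} (hf : MemLp f 2 ρ) :
    ∫ z, |f z| ∂ρ ≤ √(∫ z, f z ^ 2 ∂ρ) := by
  have := integral_mul_le_sqrt_mul_sqrt hf.abs (memLp_const (1 : ℝ))
  simpa using this

lemma sq_integral_le_integral_sq {f : Z → ℝ} (hf : MemLp f 2 ρ) :
    (∫ z, f z ∂ρ) ^ 2 ≤ ∫ z, f z ^ 2 ∂ρ := by
  have h := integral_abs_le_sqrt hf
  have h2 := (abs_integral_le_integral_abs (f := f) (μ := ρ)).trans h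
  have h3 := pow_le_pow_left₀ (abs_nonneg _) h2 2
  rwa [sq_abs, Real.sq_sqrt (integral_nonneg fun z => sq_nonneg _)] at h3

/-- Adding an increment that is centred conditionally on the past adds its second moment. -/
lemma integral_add_increment_sq {F : Z → ℝ} {D : Z × E → ℝ} (hF : MemLp F 2 ρ)
    (hD : MemLp D 2 (ρ.prod ν)) (h0 : ∀ z, ∫ w, D (z, w) ∂ν = 0) :
    ∫ q, (F q.1 + D q) ^ 2 ∂(ρ.prod ν) =
      ∫ z, F z ^ 2 ∂ρ + ∫ z, ∫ w, D (z, w) ^ 2 ∂ν ∂ρ := by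
  have hF' : MemLp (fun q : Z × E => F q.1) 2 (ρ.prod ν) := MemLp.comp_prod_fst hF
  have hFD : Integrable (fun q : Z × E => F q.1 * D q) (ρ.prod ν) := hF'.integrable_mul hD
  have e : ∀ q : Z × E, (F q.1 + D q) ^ 2 = F q.1 ^ 2 + 2 * (F q.1 * D q) + D q ^ 2 :=
    fun q => by ring
  simp_rw [e]
  rw [integral_add_three hF'.integrable_sq (hFD.const_mul 2) hD.integrable_sq, integral_const_mul,
    integral_prod _ hFD, integral_prod _ hD.integrable_sq]
  simp only [integral_const_mul, h0, mul_zero, integral_zero, add_zero]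
  rw [integral_fun_fst (fun z => F z ^ 2)]
  simp

/-- Bound for the fourth moment after adding a centred linear increment; the third moment of the
increment is absorbed by `4 q l³ x³ ≤ 2 q² l² x² + 2 l⁴ x⁴`. -/
lemma integral_add_mul_pow_four_le {F l : Z → ℝ} {ξ : E → ℝ} (hF : MemLp F 4 ρ) (hl : MemLp l 4 ρ)
    (hξ : MemLp ξ 4 ν) (h0 : ∫ w, ξ w ∂ν = 0) :
    ∫ q, (F q.1 + l q.1 * ξ q.2) ^ 4 ∂(ρ.prod ν) ≤
      ∫ z, F z ^ 4 ∂ρ + 8 * (∫ w, ξ w ^ 2 ∂ν) * ∫ z, F z ^ 2 * l z ^ 2 ∂ρ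
        + 3 * (∫ w, ξ w ^ 4 ∂ν) * ∫ z, l z ^ 4 ∂ρ := by
  have hle : ∀ q : Z × E, (F q.1 + l q.1 * ξ q.2) ^ 4 ≤
      F q.1 ^ 4 + 4 * ((F q.1 ^ 3 * l q.1) * ξ q.2) + 8 * ((F q.1 ^ 2 * l q.1 ^ 2) * ξ q.2 ^ 2)
        + 3 * (l q.1 ^ 4 * ξ q.2 ^ 4) := by
    intro q
    nlinarith [sq_nonneg (F q.1 * l q.1 * ξ q.2 - l q.1 ^ 2 * ξ q.2 ^ 2)]
  have hlξ : MemLp (fun q : Z × E => l q.1 * ξ q.2) 4 (ρ.prod ν) :=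
    MemLp.prod_mul (k := 4) (by norm_num) hl hξ
  have hsum : MemLp (fun q : Z × E => F q.1 + l q.1 * ξ q.2) 4 (ρ.prod ν) :=
    (MemLp.comp_prod_fst hF).add hlξ
  have i1 : Integrable (fun z => F z ^ 3 * l z) ρ := by
    have a : MemLp (fun z => F z ^ 2) 2 ρ := MemLp.sq_of_four hF
    have b : MemLp (fun z => F z * l z) 2 ρ := by
      refine (memLp_two_iff_integrable_sq (hF.1.mul hl.1)).2 ?_
      refine (hF.sq_of_four.integrable_mul hl.sq_of_four).congr (ae_of_all _ fun z => ?_)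
      simp [mul_pow]
    refine (a.integrable_mul b).congr (ae_of_all _ fun z => ?_)
    simp only [Pi.mul_apply]; ring
  have i2 : Integrable (fun z => F z ^ 2 * l z ^ 2) ρ :=
    (MemLp.sq_of_four hF).integrable_mul (MemLp.sq_of_four hl)
  have iξ : Integrable ξ ν := MemLp.one_of_two (MemLp.two_of_four hξ)
  have j0 : Integrable (fun q : Z × E => F q.1 ^ 4) (ρ.prod ν) :=
    (MemLp.integrable_pow_four hF).comp_fst ν
  have j1 := (i1.mul_prod iξ).const_mul 4
  have j2 := (i2.mul_prod (MemLp.two_of_four hξ).integrable_sq).const_mul 8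
  have j3 := ((MemLp.integrable_pow_four hl).mul_prod (MemLp.integrable_pow_four hξ)).const_mul 3
  calc _ ≤ ∫ q : Z × E, (F q.1 ^ 4 + 4 * ((F q.1 ^ 3 * l q.1) * ξ q.2)
        + 8 * ((F q.1 ^ 2 * l q.1 ^ 2) * ξ q.2 ^ 2) + 3 * (l q.1 ^ 4 * ξ q.2 ^ 4)) ∂(ρ.prod ν) :=
        integral_mono (MemLp.integrable_pow_four hsum) (((j0.add j1).add j2).add j3) hle
    _ = _ := by
      rw [integral_add_four j0 j1 j2 j3]
      simp only [integral_const_mul]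
      rw [integral_prod_mul (fun z => F z ^ 3 * l z) ξ,
        integral_prod_mul (fun z => F z ^ 2 * l z ^ 2) (fun w => ξ w ^ 2),
        integral_prod_mul (fun z => l z ^ 4) (fun w => ξ w ^ 4),
        integral_fun_fst (fun z => F z ^ 4), h0]
      simp only [probReal_univ, one_smul]
      ring

end Product

/-! ### Linear and off-diagonal quadratic forms in independent variables -/

/-- The linear form `∑ᵢ aᵢ ξ(zᵢ)` in the independent variables `ξ(zᵢ)`. -/
def linForm {E : Type*} {n : ℕ} (ξ : E → ℝ) (a : Fin n → ℝ) (z : Fin n → E) : ℝ :=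
  ∑ i, a i * ξ (z i)

/-- The quadratic form `∑ᵢⱼ Aᵢⱼ ξ(zᵢ) ξ(zⱼ)` in the independent variables `ξ(zᵢ)`; it is only used
for symmetric `A` with vanishing diagonal. -/
def quadForm {E : Type*} {n : ℕ} (ξ : E → ℝ) (A : Fin n → Fin n → ℝ) (z : Fin n → E) : ℝ :=
  ∑ i, ∑ j, A i j * (ξ (z i) * ξ (z j))

section Forms

lemma linForm_snoc {E : Type*} {ξ : E → ℝ} {n : ℕ} (a : Fin (n + 1) → ℝ) (z : Fin n → E) (e : E) :
    linForm ξ a (Fin.snoc z e : Fin (n + 1) → E) =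
      linForm ξ (fun i => a i.castSucc) z + a (Fin.last n) * ξ e := by
  simp [linForm, Fin.sum_univ_castSucc]

lemma quadForm_snoc {E : Type*} {ξ : E → ℝ} {n : ℕ} {A : Fin (n + 1) → Fin (n + 1) → ℝ} (hs : ∀ i j, A i j = A j i)
    (hd : ∀ i, A i i = 0) (z : Fin n → E) (e : E) :
    quadForm ξ A (Fin.snoc z e : Fin (n + 1) → E) =
      quadForm ξ (fun i j => A i.castSucc j.castSucc) z +
        2 * linForm ξ (fun i => A i.castSucc (Fin.last n)) z * ξ e := by
  simp only [quadForm, linForm, Fin.sum_univ_castSucc, Fin.snoc_castSucc, Fin.snoc_last, hd,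
    Finset.sum_add_distrib, hs (Fin.last n), Finset.mul_sum, Finset.sum_mul]
  rw [add_assoc]
  congr 1
  rw [zero_mul, add_zero, ← Finset.sum_add_distrib]
  exact Finset.sum_congr rfl fun i _ => by ring

variable {E : Type*} [MeasurableSpace E] {ν : Measure E} [IsProbabilityMeasure ν] {ξ : E → ℝ}

lemma memLp_linForm {n : ℕ} (a : Fin n → ℝ) {r : ENNReal} (hξ : MemLp ξ r ν) :
    MemLp (linForm ξ a) r (iidLaw ν n) :=
  memLp_finsetSum _ fun i _ => (hξ.comp_eval n i).const_mul (a i)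

lemma integral_linForm {n : ℕ} (a : Fin n → ℝ) (hξ : Integrable ξ ν) (h0 : ∫ e, ξ e ∂ν = 0) :
    ∫ z, linForm ξ a z ∂(iidLaw ν n) = 0 := by
  unfold linForm
  rw [integral_finsetSum _ fun i _ => (integrable_comp_eval hξ).const_mul (a i)]
  refine Finset.sum_eq_zero fun i _ => ?_
  rw [integral_const_mul, integral_comp_eval (μ := fun _ => ν) hξ.1, h0, mul_zero]

lemma integral_add_mul_sq {Z : Type*} [MeasurableSpace Z] {ρ : Measure Z} [IsProbabilityMeasure ρ]
    {F l : Z → ℝ} (hF : MemLp F 2 ρ) (hl : MemLp l 2 ρ) (hξ : MemLp ξ 2 ν)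
    (h0 : ∫ e, ξ e ∂ν = 0) :
    ∫ q, (F q.1 + l q.1 * ξ q.2) ^ 2 ∂(ρ.prod ν) =
      ∫ z, F z ^ 2 ∂ρ + (∫ e, ξ e ^ 2 ∂ν) * ∫ z, l z ^ 2 ∂ρ := by
  have hD : MemLp (fun q : Z × E => l q.1 * ξ q.2) 2 (ρ.prod ν) :=
    MemLp.prod_mul (k := 2) (by norm_num) hl hξ
  rw [integral_add_increment_sq hF hD fun z => by simp [integral_const_mul, h0]]
  simp only [mul_pow, integral_const_mul, integral_mul_const]
  ring

lemma integral_linForm_sq {n : ℕ} (a : Fin n → ℝ) (hξ : MemLp ξ 2 ν) (h0 : ∫ e, ξ e ∂ν = 0) :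
    ∫ z, linForm ξ a z ^ 2 ∂(iidLaw ν n) = (∫ e, ξ e ^ 2 ∂ν) * ∑ i, a i ^ 2 := by
  induction n with
  | zero => simp [linForm]
  | succ n ih =>
    rw [integral_iidLaw_succ]
    simp only [linForm_snoc]
    rw [integral_add_mul_sq (l := fun _ => a (Fin.last n)) (memLp_linForm _ hξ)
      (memLp_const _) hξ h0, ih, Fin.sum_univ_castSucc]
    simp
    ring

lemma integral_linForm_pow_four_le {n : ℕ} (a : Fin n → ℝ) (hξ : MemLp ξ 4 ν)
    (h0 : ∫ e, ξ e ∂ν = 0) :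
    ∫ z, linForm ξ a z ^ 4 ∂(iidLaw ν n) ≤ 4 * (∫ e, ξ e ^ 4 ∂ν) * (∑ i, a i ^ 2) ^ 2 := by
  have hκ : (∫ e, ξ e ^ 2 ∂ν) ^ 2 ≤ ∫ e, ξ e ^ 4 ∂ν := by
    simpa [← pow_mul] using sq_integral_le_integral_sq hξ.sq_of_four
  have hm : 0 ≤ ∫ e, ξ e ^ 4 ∂ν := integral_nonneg fun e => by positivity
  induction n with
  | zero => simp [linForm]
  | succ n ih =>
    rw [integral_iidLaw_succ]
    simp only [linForm_snoc]
    refine (integral_add_mul_pow_four_le (l := fun _ => a (Fin.last n)) (memLp_linForm _ hξ)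
      (memLp_const _) hξ h0).trans ?_
    rw [integral_mul_const, integral_linForm_sq _ hξ.two_of_four h0, Fin.sum_univ_castSucc]
    have ih' := ih (fun i => a i.castSucc)
    simp only [integral_const, probReal_univ, one_smul]
    have hS : 0 ≤ ∑ i : Fin n, a i.castSucc ^ 2 := Finset.sum_nonneg fun i _ => sq_nonneg _
    set S := ∑ i : Fin n, a i.castSucc ^ 2
    set m := ∫ e, ξ e ^ 4 ∂ν
    set κ := ∫ e, ξ e ^ 2 ∂ν
    set b := a (Fin.last n)
    have h1 : κ ^ 2 * (S * b ^ 2) ≤ m * (S * b ^ 2) := by gcongr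
    have h2 : 0 ≤ m * b ^ 4 := by positivity
    nlinarith

section Quadratic

variable {n : ℕ} {A : Fin n → Fin n → ℝ}

/-- Two independent copies of `ξ` have a product with the same integrability as `ξ`. -/
lemma memLp_mul_eval {k : ℕ} (hk : k ≠ 0) (hξ : MemLp ξ k ν) {i j : Fin n} (hij : i ≠ j) :
    MemLp (fun z : Fin n → E => ξ (z i) * ξ (z j)) k (iidLaw ν n) := by
  refine memLp_of_integrable_pow ((hξ.comp_eval n i).1.mul (hξ.comp_eval n j).1) hk ?_
  have hind : IndepFun (fun z : Fin n → E => ‖ξ (z i)‖ ^ k) (fun z => ‖ξ (z j)‖ ^ k)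
      (iidLaw ν n) := by
    have := iIndepFun_pi (μ := fun _ : Fin n => ν) (X := fun _ e => ‖ξ e‖ ^ k)
      fun _ => (hξ.1.aemeasurable.norm.pow_const k)
    exact this.indepFun hij
  have := hind.integrable_mul ((hξ.comp_eval n i).integrable_norm_pow hk)
    ((hξ.comp_eval n j).integrable_norm_pow hk)
  refine this.congr (ae_of_all _ fun z => ?_)
  simp [mul_pow]

lemma memLp_quadForm {k : ℕ} (hk : k ≠ 0) (hξ : MemLp ξ k ν) (hd : ∀ i, A i i = 0) :
    MemLp (quadForm ξ A) k (iidLaw ν n) := by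
  refine memLp_finsetSum _ fun i _ => memLp_finsetSum _ fun j _ => ?_
  by_cases hij : i = j
  · simp [hij, hd]
  · exact (memLp_mul_eval hk hξ hij).const_mul _

lemma integral_quadForm (hξ : Integrable ξ ν) (h0 : ∫ e, ξ e ∂ν = 0) (hd : ∀ i, A i i = 0) :
    ∫ z, quadForm ξ A z ∂(iidLaw ν n) = 0 := by
  have hint : ∀ i j, Integrable (fun z : Fin n → E => A i j * (ξ (z i) * ξ (z j)))
      (iidLaw ν n) := by
    intro i j
    by_cases hij : i = j
    · simp [hij, hd]
    · exact Integrable.const_mul (memLp_one_iff_integrable.1 (by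
        simpa using memLp_mul_eval (k := 1) one_ne_zero
          (by simpa using memLp_one_iff_integrable.2 hξ) hij)) _
  unfold quadForm
  rw [integral_finsetSum _ fun i _ => integrable_finsetSum _ fun j _ => hint i j]
  refine Finset.sum_eq_zero fun i _ => ?_
  rw [integral_finsetSum _ fun j _ => hint i j]
  refine Finset.sum_eq_zero fun j _ => ?_
  by_cases hij : i = j
  · simp [hij, hd]
  · have hind := (iIndepFun_pi (μ := fun _ : Fin n => ν) (X := fun _ => ξ)
      fun _ => hξ.1.aemeasurable).indepFun hij
    have hi : AEStronglyMeasurable (fun z : Fin n → E => ξ (z i)) (iidLaw ν n) :=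
      (integrable_comp_eval hξ).1
    have hj : AEStronglyMeasurable (fun z : Fin n → E => ξ (z j)) (iidLaw ν n) :=
      (integrable_comp_eval hξ).1
    rw [integral_const_mul, hind.integral_fun_mul_eq_mul_integral hi hj,
      integral_comp_eval (μ := fun _ => ν) hξ.1, h0]
    simp

end Quadratic

lemma integral_quadForm_sq {n : ℕ} {A : Fin n → Fin n → ℝ} (hξ : MemLp ξ 2 ν)
    (h0 : ∫ e, ξ e ∂ν = 0) (hs : ∀ i j, A i j = A j i) (hd : ∀ i, A i i = 0) :
    ∫ z, quadForm ξ A z ^ 2 ∂(iidLaw ν n) =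
      2 * (∫ e, ξ e ^ 2 ∂ν) ^ 2 * ∑ i, ∑ j, A i j ^ 2 := by
  induction n with
  | zero => simp [quadForm]
  | succ n ih =>
    rw [integral_iidLaw_succ]
    simp only [quadForm_snoc hs hd]
    rw [integral_add_mul_sq
      (F := quadForm ξ (fun i j : Fin n => A i.castSucc j.castSucc))
      (l := fun z => 2 * linForm ξ (fun i : Fin n => A i.castSucc (Fin.last n)) z)
      (memLp_quadForm (k := 2) two_ne_zero hξ (fun i => hd _))
      ((memLp_linForm _ hξ).const_mul 2) hξ h0, ih (fun i j => hs _ _) (fun i => hd _)]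
    simp only [mul_pow, integral_const_mul, integral_linForm_sq _ hξ h0]
    simp only [Fin.sum_univ_castSucc, hd, Finset.sum_add_distrib, hs (Fin.last n)]
    ring

/-- A quadratic form without diagonal in i.i.d. centred variables satisfies a reverse Hölder
inequality between `L⁴` and `L²`, with a constant which does not depend on the number of
variables. -/
lemma integral_quadForm_pow_four_le {n : ℕ} {A : Fin n → Fin n → ℝ} (hξ : MemLp ξ 4 ν)
    (h0 : ∫ e, ξ e ∂ν = 0) (hs : ∀ i j, A i j = A j i) (hd : ∀ i, A i i = 0) :
    ∫ z, quadForm ξ A z ^ 4 ∂(iidLaw ν n) ≤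
      256 * (∫ e, ξ e ^ 4 ∂ν) ^ 2 * (∑ i, ∑ j, A i j ^ 2) ^ 2 := by
  have hκ : (∫ e, ξ e ^ 2 ∂ν) ^ 2 ≤ ∫ e, ξ e ^ 4 ∂ν := by
    simpa [← pow_mul] using sq_integral_le_integral_sq hξ.sq_of_four
  have hm : 0 ≤ ∫ e, ξ e ^ 4 ∂ν := integral_nonneg fun e => by positivity
  have hκ0 : 0 ≤ ∫ e, ξ e ^ 2 ∂ν := integral_nonneg fun e => by positivity
  induction n with
  | zero => simp [quadForm]
  | succ n ih =>
    rw [integral_iidLaw_succ]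
    simp only [quadForm_snoc hs hd]
    have hQ := memLp_quadForm (k := 4) (n := n) (A := fun i j : Fin n => A i.castSucc j.castSucc)
      (by norm_num) hξ (fun i => hd _)
    have hl := memLp_linForm (fun i : Fin n => A i.castSucc (Fin.last n)) hξ
    refine (integral_add_mul_pow_four_le
      (l := fun z => 2 * linForm ξ (fun i : Fin n => A i.castSucc (Fin.last n)) z)
      hQ (hl.const_mul 2) hξ h0).trans ?_
    have ih' := ih (A := fun i j : Fin n => A i.castSucc j.castSucc)
      (fun i j => hs _ _) (fun i => hd _)
    have hl4 := integral_linForm_pow_four_le (fun i : Fin n => A i.castSucc (Fin.last n)) hξ h0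
    have hcs := integral_mul_le_sqrt_mul_sqrt hQ.sq_of_four hl.sq_of_four
    simp only [← pow_mul, Nat.reduceMul] at hcs
    have hq : 0 ≤ ∑ i : Fin n, ∑ j : Fin n, A i.castSucc j.castSucc ^ 2 :=
      Finset.sum_nonneg fun i _ => Finset.sum_nonneg fun j _ => sq_nonneg _
    have hr : 0 ≤ ∑ i : Fin n, A i.castSucc (Fin.last n) ^ 2 :=
      Finset.sum_nonneg fun i _ => sq_nonneg _
    simp only [mul_pow]
    have e1 : ∀ z : Fin n → E, quadForm ξ (fun i j : Fin n => A i.castSucc j.castSucc) z ^ 2 *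
        (2 ^ 2 * linForm ξ (fun i : Fin n => A i.castSucc (Fin.last n)) z ^ 2) =
        4 * (quadForm ξ (fun i j : Fin n => A i.castSucc j.castSucc) z ^ 2 *
        linForm ξ (fun i : Fin n => A i.castSucc (Fin.last n)) z ^ 2) := fun z => by ring
    simp only [e1, integral_const_mul]
    simp only [Fin.sum_univ_castSucc, hd, Finset.sum_add_distrib, hs (Fin.last n)]
    set q := ∑ i : Fin n, ∑ j : Fin n, A i.castSucc j.castSucc ^ 2
    set r := ∑ i : Fin n, A i.castSucc (Fin.last n) ^ 2
    set m := ∫ e, ξ e ^ 4 ∂ν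
    set κ := ∫ e, ξ e ^ 2 ∂ν
    have s1 : √(∫ z, quadForm ξ (fun i j : Fin n => A i.castSucc j.castSucc) z ^ 4 ∂(iidLaw ν n))
        ≤ 16 * m * q := by
      refine Real.sqrt_le_iff.2 ⟨by positivity, ih'.trans (le_of_eq (by ring))⟩
    have s2 : √(∫ z, linForm ξ (fun i : Fin n => A i.castSucc (Fin.last n)) z ^ 4 ∂(iidLaw ν n))
        ≤ 2 * √m * r := by
      refine Real.sqrt_le_iff.2 ⟨by positivity, hl4.trans (le_of_eq ?_)⟩
      rw [mul_pow, mul_pow, Real.sq_sqrt hm]; ring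
    have hκm : κ ≤ √m := Real.le_sqrt_of_sq_le hκ
    have h1 : κ * ∫ z, quadForm ξ (fun i j : Fin n => A i.castSucc j.castSucc) z ^ 2 *
        linForm ξ (fun i : Fin n => A i.castSucc (Fin.last n)) z ^ 2 ∂(iidLaw ν n)
        ≤ 32 * m ^ 2 * (q * r) := by
      calc _ ≤ √m * ((16 * m * q) * (2 * √m * r)) := by
            refine mul_le_mul hκm (hcs.trans (mul_le_mul s1 s2 (Real.sqrt_nonneg _)
              (by positivity))) ?_ (Real.sqrt_nonneg _)
            exact integral_nonneg fun z => by positivity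
        _ = 32 * m * (√m * √m) * (q * r) := by ring
        _ = _ := by rw [Real.mul_self_sqrt hm]; ring
    have h2 : m * ∫ z, linForm ξ (fun i : Fin n => A i.castSucc (Fin.last n)) z ^ 4 ∂(iidLaw ν n)
        ≤ m * (4 * m * r ^ 2) := by gcongr
    have h3 : 0 ≤ m ^ 2 * (q * r) := by positivity
    have h4 : 0 ≤ m ^ 2 * r ^ 2 := by positivity
    nlinarith

end Forms

/-! ### Sums over the entries of a sample -/

/-- The matrix with zeros on the diagonal and ones elsewhere. -/
def offDiag {n : ℕ} (i j : Fin n) : ℝ := if i = j then 0 else 1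

/-- The off-diagonal part of the Gram matrix `∑ₜ zₜ zₜᵀ`. -/
def gramOff {n p : ℕ} (z : Fin n → Fin p → ℝ) (i j : Fin p) : ℝ :=
  if i = j then 0 else ∑ t, z t i * z t j

/-- The sum of the squared off-diagonal entries of the Gram matrix. -/
def gramSq {n p : ℕ} (z : Fin n → Fin p → ℝ) : ℝ :=
  ∑ i, ∑ j, gramOff z i j ^ 2

/-- The sum `∑ z_{si} z_{sj} z_{ti} z_{tj}` over `s ≠ t` and `i ≠ j`, as `gramSq` without the
terms `s = t`. -/
def crossSum {n p : ℕ} (z : Fin n → Fin p → ℝ) : ℝ :=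
  gramSq z - ∑ t, quadForm (fun x => x ^ 2) offDiag (z t)

/-- The sum of `f` over all entries of the sample. -/
def entrySum {n p : ℕ} (f : ℝ → ℝ) (z : Fin n → Fin p → ℝ) : ℝ :=
  ∑ t, ∑ i, f (z t i)

/-- `∑ᵢ ∑_{s ≠ t} f(z_{si}) f(z_{ti})`. -/
def rowPairs {n p : ℕ} (f : ℝ → ℝ) (z : Fin n → Fin p → ℝ) : ℝ :=
  ∑ i, quadForm (fun w : Fin p → ℝ => f (w i)) offDiag z

/-- `∑ₜ ∑_{i ≠ j} f(z_{ti}) f(z_{tj})`. -/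
def colPairs {n p : ℕ} (f : ℝ → ℝ) (z : Fin n → Fin p → ℝ) : ℝ :=
  ∑ t, quadForm f offDiag (z t)

lemma offDiag_symm {n : ℕ} (i j : Fin n) : offDiag i j = offDiag j i := by
  simp [offDiag, eq_comm]

lemma offDiag_self {n : ℕ} (i : Fin n) : offDiag i i = 0 := by simp [offDiag]

lemma offDiag_sq {n : ℕ} (i j : Fin n) : offDiag i j ^ 2 = offDiag i j := by
  unfold offDiag; split_ifs <;> simp

lemma sum_offDiag_mul {n : ℕ} (f : Fin n → ℝ) (i : Fin n) :
    ∑ j, offDiag i j * f j = ∑ j, f j - f i := by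
  have : ∀ j, offDiag i j * f j = f j - if i = j then f j else 0 := by
    intro j; unfold offDiag; split_ifs <;> simp
  simp [this, Finset.sum_sub_distrib]

lemma sum_sum_offDiag (n : ℕ) : ∑ i : Fin n, ∑ j : Fin n, offDiag i j = n * (n - 1) := by
  have := fun i => sum_offDiag_mul (n := n) (fun _ => 1) i
  simp only [mul_one] at this
  simp [this]
  ring

lemma quadForm_offDiag {E : Type*} {n : ℕ} (ξ : E → ℝ) (z : Fin n → E) :
    quadForm ξ offDiag z = (∑ i, ξ (z i)) ^ 2 - ∑ i, ξ (z i) ^ 2 := by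
  have : ∀ i, ∑ j, offDiag i j * (ξ (z i) * ξ (z j)) =
      ξ (z i) * ∑ j, ξ (z j) - ξ (z i) ^ 2 := fun i => by
    rw [sum_offDiag_mul (fun j => ξ (z i) * ξ (z j)) i, Finset.mul_sum]; ring
  simp only [quadForm, this, Finset.sum_sub_distrib, ← Finset.sum_mul]
  ring

lemma quadForm_sq_offDiag {n : ℕ} (w : Fin n → ℝ) :
    quadForm (fun x => x ^ 2) offDiag w =
      quadForm (fun x => x ^ 2 - 1) offDiag w + 2 * (n - 1) * ∑ i, (w i ^ 2 - 1) + n * (n - 1) := by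
  simp only [quadForm_offDiag, sub_sq, Finset.sum_sub_distrib, Finset.sum_add_distrib]
  simp only [Finset.sum_const, Finset.card_univ, Fintype.card_fin, nsmul_eq_mul, mul_one,
    ← Finset.mul_sum]
  ring

lemma gramOff_symm {n p : ℕ} (z : Fin n → Fin p → ℝ) (i j : Fin p) :
    gramOff z i j = gramOff z j i := by
  simp [gramOff, eq_comm, mul_comm]

lemma gramOff_self {n p : ℕ} (z : Fin n → Fin p → ℝ) (i : Fin p) : gramOff z i i = 0 := by
  simp [gramOff]

lemma gramOff_snoc {n p : ℕ} (z : Fin n → Fin p → ℝ) (w : Fin p → ℝ) (i j : Fin p) :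
    gramOff (Fin.snoc z w : Fin (n + 1) → Fin p → ℝ) i j =
      gramOff z i j + offDiag i j * (w i * w j) := by
  unfold gramOff offDiag
  split_ifs
  · simp
  · simp [Fin.sum_univ_castSucc]

lemma gramSq_snoc {n p : ℕ} (z : Fin n → Fin p → ℝ) (w : Fin p → ℝ) :
    gramSq (Fin.snoc z w : Fin (n + 1) → Fin p → ℝ) =
      gramSq z + 2 * quadForm (fun x => x) (gramOff z) w
        + quadForm (fun x => x ^ 2) offDiag w := by
  simp only [gramSq, quadForm, gramOff_snoc, Finset.mul_sum, ← Finset.sum_add_distrib]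
  refine Finset.sum_congr rfl fun i _ => Finset.sum_congr rfl fun j _ => ?_
  have h : gramOff z i j * offDiag i j = gramOff z i j := by
    unfold gramOff offDiag; split_ifs <;> simp
  have h2 := offDiag_sq i j
  linear_combination (2 * w i * w j) * h + (w i ^ 2 * w j ^ 2) * h2

lemma crossSum_snoc {n p : ℕ} (z : Fin n → Fin p → ℝ) (w : Fin p → ℝ) :
    crossSum (Fin.snoc z w : Fin (n + 1) → Fin p → ℝ) =
      crossSum z + 2 * quadForm (fun x => x) (gramOff z) w := by
  simp only [crossSum, gramSq_snoc, Fin.sum_univ_castSucc, Fin.snoc_castSucc, Fin.snoc_last]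
  ring

lemma entrySum_snoc {n p : ℕ} (f : ℝ → ℝ) (z : Fin n → Fin p → ℝ) (w : Fin p → ℝ) :
    entrySum f (Fin.snoc z w : Fin (n + 1) → Fin p → ℝ) = entrySum f z + ∑ i, f (w i) := by
  simp [entrySum, Fin.sum_univ_castSucc]

lemma rowPairs_snoc {n p : ℕ} (f : ℝ → ℝ) (z : Fin n → Fin p → ℝ) (w : Fin p → ℝ) :
    rowPairs f (Fin.snoc z w : Fin (n + 1) → Fin p → ℝ) =
      rowPairs f z + linForm f (fun i => 2 * ∑ t, f (z t i)) w := by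
  simp only [rowPairs, quadForm_snoc offDiag_symm offDiag_self, linForm,
    ← Finset.sum_add_distrib]
  refine Finset.sum_congr rfl fun i _ => ?_
  have h1 : ∀ s t : Fin n, offDiag s.castSucc t.castSucc = offDiag s t := fun s t => by
    simp [offDiag]
  have h2 : ∀ s : Fin n, offDiag s.castSucc (Fin.last n) = 1 := fun s => by
    simp [offDiag, (Fin.castSucc_lt_last s).ne]
  simp [h1, h2]

lemma entrySum_eq_linForm {n p : ℕ} (f : ℝ → ℝ) :
    (entrySum f : (Fin n → Fin p → ℝ) → ℝ) = linForm (linForm f fun _ => 1) fun _ => 1 := by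
  ext z; simp [entrySum, linForm]

lemma colPairs_eq_linForm {n p : ℕ} (f : ℝ → ℝ) :
    (colPairs f : (Fin n → Fin p → ℝ) → ℝ) = linForm (quadForm f offDiag) fun _ => 1 := by
  ext z; simp [colPairs, linForm]

section Moments

variable {μ : Measure ℝ} [IsProbabilityMeasure μ] {f : ℝ → ℝ} {n p : ℕ}

/-- The law of a sample of `n` vectors in `ℝᵖ` whose entries are i.i.d. with law `μ`. -/
noncomputable abbrev sampleLaw (μ : Measure ℝ) [IsProbabilityMeasure μ] (n p : ℕ) :
    Measure (Fin n → Fin p → ℝ) :=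
  iidLaw (iidLaw μ p) n

lemma memLp_entrySum {r : ENNReal} (hf : MemLp f r μ) :
    MemLp (entrySum f) r (sampleLaw μ n p) := by
  rw [entrySum_eq_linForm]
  exact memLp_linForm _ (memLp_linForm _ hf)

lemma integral_entrySum (hf : Integrable f μ) (h0 : ∫ x, f x ∂μ = 0) :
    ∫ z, entrySum f z ∂(sampleLaw μ n p) = 0 := by
  rw [entrySum_eq_linForm]
  refine integral_linForm _ ?_ (integral_linForm _ hf h0)
  exact memLp_one_iff_integrable.1 (memLp_linForm _ (memLp_one_iff_integrable.2 hf))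

lemma integral_entrySum_sq (hf : MemLp f 2 μ) (h0 : ∫ x, f x ∂μ = 0) :
    ∫ z, entrySum f z ^ 2 ∂(sampleLaw μ n p) = n * p * ∫ x, f x ^ 2 ∂μ := by
  rw [entrySum_eq_linForm, integral_linForm_sq _ (memLp_linForm _ hf)
    (integral_linForm _ hf.one_of_two h0), integral_linForm_sq _ hf h0]
  simp
  ring

lemma integral_abs_entrySum_le (hf : Integrable f μ) :
    ∫ z, |entrySum f z| ∂(sampleLaw μ n p) ≤ n * p * ∫ x, |f x| ∂μ := by
  have hi : ∀ (t : Fin n) (i : Fin p), Integrable (fun z : Fin n → Fin p → ℝ => |f (z t i)|)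
      (sampleLaw μ n p) := fun t i =>
    memLp_one_iff_integrable.1
      (((memLp_one_iff_integrable.2 hf.abs).comp_eval p i).comp_eval n t)
  have hI : Integrable (entrySum f) (sampleLaw μ n p) :=
    memLp_one_iff_integrable.1 (memLp_entrySum (memLp_one_iff_integrable.2 hf))
  calc ∫ z, |entrySum f z| ∂(sampleLaw μ n p)
      ≤ ∫ z : Fin n → Fin p → ℝ, ∑ t, ∑ i, |f (z t i)| ∂(sampleLaw μ n p) := by
        refine integral_mono hI.abs
          (integrable_finsetSum _ fun t _ => integrable_finsetSum _ fun i _ => hi t i) fun z => ?_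
        refine (Finset.abs_sum_le_sum_abs _ _).trans (Finset.sum_le_sum fun t _ => ?_)
        exact Finset.abs_sum_le_sum_abs _ _
    _ = ∑ t : Fin n, ∑ i : Fin p, ∫ x, |f x| ∂μ := by
        rw [integral_finsetSum _ fun t _ => integrable_finsetSum _ fun i _ => hi t i]
        refine Finset.sum_congr rfl fun t _ => ?_
        rw [integral_finsetSum _ fun i _ => hi t i]
        refine Finset.sum_congr rfl fun i _ => ?_
        rw [integral_comp_eval (μ := fun _ : Fin n => iidLaw μ p)
            (f := fun w : Fin p → ℝ => |f (w i)|)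
            ((memLp_one_iff_integrable.2 hf.abs).comp_eval p i).1,
          integral_comp_eval (μ := fun _ : Fin p => μ) (f := fun x => |f x|) hf.abs.1]
    _ = _ := by simp; ring

lemma memLp_colPairs (hf : MemLp f 2 μ) : MemLp (colPairs f) 2 (sampleLaw μ n p) := by
  rw [colPairs_eq_linForm]
  exact memLp_linForm _ (memLp_quadForm (k := 2) two_ne_zero hf offDiag_self)

lemma integral_colPairs (hf : MemLp f 2 μ) (h0 : ∫ x, f x ∂μ = 0) :
    ∫ z, colPairs f z ∂(sampleLaw μ n p) = 0 := by
  rw [colPairs_eq_linForm]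
  exact integral_linForm _ (memLp_quadForm (k := 2) two_ne_zero hf offDiag_self).one_of_two
    (integral_quadForm hf.one_of_two h0 offDiag_self)

lemma integral_colPairs_sq_le (hf : MemLp f 2 μ) (h0 : ∫ x, f x ∂μ = 0) :
    ∫ z, colPairs f z ^ 2 ∂(sampleLaw μ n p) ≤ 2 * n * p ^ 2 * (∫ x, f x ^ 2 ∂μ) ^ 2 := by
  rw [colPairs_eq_linForm, integral_linForm_sq _
    (memLp_quadForm (k := 2) two_ne_zero hf offDiag_self)
    (integral_quadForm hf.one_of_two h0 offDiag_self),
    integral_quadForm_sq hf h0 offDiag_symm offDiag_self]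
  simp only [offDiag_sq, sum_sum_offDiag]
  simp only [one_pow, Finset.sum_const, Finset.card_univ, Fintype.card_fin, nsmul_eq_mul, mul_one]
  have h : 0 ≤ (n : ℝ) * p * (∫ x, f x ^ 2 ∂μ) ^ 2 := by positivity
  nlinarith

lemma memLp_rowPairs (hf : MemLp f 2 μ) : MemLp (rowPairs f) 2 (sampleLaw μ n p) :=
  memLp_finsetSum _ fun i _ =>
    memLp_quadForm (k := 2) two_ne_zero (hf.comp_eval p i) offDiag_self

lemma integral_rowPairs (hf : MemLp f 2 μ) (h0 : ∫ x, f x ∂μ = 0) :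
    ∫ z, rowPairs f z ∂(sampleLaw μ n p) = 0 := by
  unfold rowPairs
  rw [integral_finsetSum _ fun i _ =>
    (memLp_quadForm (k := 2) two_ne_zero (hf.comp_eval p i) offDiag_self).one_of_two]
  refine Finset.sum_eq_zero fun i _ =>
    integral_quadForm (hf.comp_eval p i).one_of_two ?_ offDiag_self
  rw [integral_comp_eval (μ := fun _ : Fin p => μ) hf.1, h0]

lemma integral_rowPairs_sq_le (hf : MemLp f 2 μ) (h0 : ∫ x, f x ∂μ = 0) :
    ∫ z, rowPairs f z ^ 2 ∂(sampleLaw μ n p) ≤ 2 * n ^ 2 * p * (∫ x, f x ^ 2 ∂μ) ^ 2 := by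
  induction n with
  | zero => simp [rowPairs, quadForm]
  | succ n ih =>
    have hcol : ∀ i : Fin p, MemLp (fun z : Fin n → Fin p → ℝ => ∑ t, f (z t i)) 2
        (sampleLaw μ n p) := fun i =>
      memLp_finsetSum _ fun t _ => (hf.comp_eval p i).comp_eval n t
    have hD : MemLp (fun q : (Fin n → Fin p → ℝ) × (Fin p → ℝ) =>
        linForm f (fun i => 2 * ∑ t, f (q.1 t i)) q.2) 2 ((sampleLaw μ n p).prod (iidLaw μ p)) :=
      memLp_finsetSum _ fun i _ => MemLp.prod_mul (k := 2) two_ne_zero ((hcol i).const_mul 2)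
        (hf.comp_eval p i)
    have hcolsq : ∀ i : Fin p, ∫ z : Fin n → Fin p → ℝ, (∑ t, f (z t i)) ^ 2 ∂(sampleLaw μ n p)
        = n * ∫ x, f x ^ 2 ∂μ := by
      intro i
      have := integral_linForm_sq (n := n) (fun _ => 1) (hf.comp_eval p i)
        (by rw [integral_comp_eval (μ := fun _ : Fin p => μ) hf.1, h0])
      simp only [linForm, one_mul] at this
      rw [this, integral_comp_eval (μ := fun _ : Fin p => μ) (f := fun x => f x ^ 2) (hf.1.pow 2)]
      simp
      ring
    rw [integral_iidLaw_succ]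
    simp only [rowPairs_snoc]
    rw [integral_add_increment_sq (D := fun q : (Fin n → Fin p → ℝ) × (Fin p → ℝ) =>
        linForm f (fun i => 2 * ∑ t, f (q.1 t i)) q.2) (memLp_rowPairs hf) hD
        (fun z => integral_linForm (fun i => 2 * ∑ t, f (z t i)) hf.one_of_two h0)]
    simp only [integral_linForm_sq _ hf h0, mul_pow, integral_const_mul, ← Finset.mul_sum]
    rw [integral_finsetSum _ fun i _ => (hcol i).integrable_sq]
    simp only [hcolsq]
    simp only [Finset.sum_const, Finset.card_univ, Fintype.card_fin, nsmul_eq_mul]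
    push_cast
    have h : 0 ≤ (p : ℝ) * (∫ x, f x ^ 2 ∂μ) ^ 2 := by positivity
    nlinarith

end Moments

/-! ### Concentration of the off-diagonal Gram entries -/

section Gram

variable {μ : Measure ℝ} [IsProbabilityMeasure μ] {n p : ℕ}

lemma memLp_sq_sub_one (hx : MemLp (fun x : ℝ => x) 4 μ) :
    MemLp (fun x : ℝ => x ^ 2 - 1) 2 μ :=
  hx.sq_of_four.sub (memLp_const 1)

lemma integral_sq_sub_one (hx : MemLp (fun x : ℝ => x) 4 μ) (h2 : ∫ x, x ^ 2 ∂μ = 1) :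
    ∫ x, (x ^ 2 - 1) ∂μ = 0 := by
  rw [integral_sub hx.two_of_four.integrable_sq (integrable_const _), h2]
  simp

lemma memLp_colSq (hx : MemLp (fun x : ℝ => x) 4 μ) :
    MemLp (quadForm (fun x : ℝ => x ^ 2) offDiag) 2 (iidLaw μ p) :=
  memLp_quadForm (k := 2) two_ne_zero hx.sq_of_four offDiag_self

lemma colSq_sub (w : Fin p → ℝ) : quadForm (fun x => x ^ 2) offDiag w - p * (p - 1) =
    quadForm (fun x => x ^ 2 - 1) offDiag w
      + linForm (fun x => x ^ 2 - 1) (fun _ => 2 * ((p : ℝ) - 1)) w := by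
  rw [quadForm_sq_offDiag, linForm, ← Finset.mul_sum]
  ring

lemma integral_colSq_sub (hx : MemLp (fun x : ℝ => x) 4 μ) (h2 : ∫ x, x ^ 2 ∂μ = 1) :
    ∫ w : Fin p → ℝ, (quadForm (fun x => x ^ 2) offDiag w - p * (p - 1)) ∂(iidLaw μ p) = 0 := by
  have hy := memLp_sq_sub_one hx
  have hy0 := integral_sq_sub_one hx h2
  simp only [colSq_sub]
  rw [integral_add (memLp_quadForm (k := 2) two_ne_zero hy offDiag_self).one_of_two
    (memLp_linForm _ hy).one_of_two, integral_quadForm hy.one_of_two hy0 offDiag_self,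
    integral_linForm _ hy.one_of_two hy0, add_zero]

lemma integral_colSq (hx : MemLp (fun x : ℝ => x) 4 μ) (h2 : ∫ x, x ^ 2 ∂μ = 1) :
    ∫ w : Fin p → ℝ, quadForm (fun x => x ^ 2) offDiag w ∂(iidLaw μ p) = p * (p - 1) := by
  have h := integral_colSq_sub (p := p) hx h2
  rw [integral_sub (memLp_colSq hx).one_of_two (integrable_const _)] at h
  simp only [integral_const, probReal_univ, one_smul] at h
  linarith

lemma integral_colSq_sub_sq_le (hx : MemLp (fun x : ℝ => x) 4 μ) (h2 : ∫ x, x ^ 2 ∂μ = 1) :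
    ∫ w : Fin p → ℝ, (quadForm (fun x => x ^ 2) offDiag w - p * (p - 1)) ^ 2 ∂(iidLaw μ p) ≤
      4 * (∫ x, (x ^ 2 - 1) ^ 2 ∂μ) ^ 2 * (p : ℝ) ^ 2
        + 8 * (∫ x, (x ^ 2 - 1) ^ 2 ∂μ) * (p : ℝ) ^ 3 := by
  have hy := memLp_sq_sub_one hx
  have hy0 := integral_sq_sub_one hx h2
  have hQ := memLp_quadForm (k := 2) (n := p) two_ne_zero hy offDiag_self
  have hL := memLp_linForm (fun _ : Fin p => 2 * ((p : ℝ) - 1)) hy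
  have hκ : 0 ≤ ∫ x, (x ^ 2 - 1) ^ 2 ∂μ := integral_nonneg fun x => sq_nonneg _
  calc _ ≤ ∫ w : Fin p → ℝ, (2 * quadForm (fun x => x ^ 2 - 1) offDiag w ^ 2
        + 2 * linForm (fun x => x ^ 2 - 1) (fun _ => 2 * ((p : ℝ) - 1)) w ^ 2) ∂(iidLaw μ p) := by
        refine integral_mono ?_ ((hQ.integrable_sq.const_mul 2).add
          (hL.integrable_sq.const_mul 2)) fun w => ?_
        · exact ((memLp_colSq hx).sub (memLp_const _)).integrable_sq
        · simp only [colSq_sub]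
          nlinarith [sq_nonneg (quadForm (fun x => x ^ 2 - 1) offDiag w -
            linForm (fun x => x ^ 2 - 1) (fun _ => 2 * ((p : ℝ) - 1)) w)]
    _ = 2 * (2 * (∫ x, (x ^ 2 - 1) ^ 2 ∂μ) ^ 2 * ((p : ℝ) * (p - 1)))
        + 2 * ((∫ x, (x ^ 2 - 1) ^ 2 ∂μ) * ((p : ℝ) * (2 * ((p : ℝ) - 1)) ^ 2)) := by
        rw [integral_add (hQ.integrable_sq.const_mul 2) (hL.integrable_sq.const_mul 2),
          integral_const_mul, integral_const_mul, integral_linForm_sq _ hy hy0,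
          integral_quadForm_sq hy hy0 offDiag_symm offDiag_self]
        simp only [offDiag_sq, sum_sum_offDiag]
        simp
    _ ≤ _ := by
        have hp : (0 : ℝ) ≤ p := Nat.cast_nonneg p
        have hp2 : ((p : ℝ) - 1) ^ 2 * p ≤ p ^ 2 * p := by
          rcases Nat.eq_zero_or_pos p with rfl | h
          · simp
          · have : (1 : ℝ) ≤ p := by exact_mod_cast h
            gcongr
            linarith
        have a1 : (∫ x, (x ^ 2 - 1) ^ 2 ∂μ) ^ 2 * ((p : ℝ) * (p - 1)) ≤
            (∫ x, (x ^ 2 - 1) ^ 2 ∂μ) ^ 2 * (p : ℝ) ^ 2 := by gcongr; nlinarith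
        have a2 := mul_le_mul_of_nonneg_left hp2 hκ
        nlinarith

lemma memLp_gramOff (hx : MemLp (fun x : ℝ => x) 4 μ) (i j : Fin p) :
    MemLp (fun z : Fin n → Fin p → ℝ => gramOff z i j) 4 (sampleLaw μ n p) := by
  by_cases hij : i = j
  · simp [gramOff, hij]
  · simp only [gramOff, if_neg hij]
    exact memLp_finsetSum _ fun t _ =>
      (memLp_mul_eval (k := 4) (by norm_num) hx hij).comp_eval n t

lemma memLp_gramSq (hx : MemLp (fun x : ℝ => x) 4 μ) :
    MemLp (gramSq : (Fin n → Fin p → ℝ) → ℝ) 2 (sampleLaw μ n p) :=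
  memLp_finsetSum _ fun i _ => memLp_finsetSum _ fun j _ => (memLp_gramOff hx i j).sq_of_four

lemma memLp_crossSum (hx : MemLp (fun x : ℝ => x) 4 μ) :
    MemLp (crossSum : (Fin n → Fin p → ℝ) → ℝ) 2 (sampleLaw μ n p) :=
  (memLp_gramSq hx).sub (memLp_finsetSum _ fun t _ => (memLp_colSq hx).comp_eval n t)

/-- The increment of the centred `gramSq` when an observation is added. -/
def gramSqIncr {n p : ℕ} (q : (Fin n → Fin p → ℝ) × (Fin p → ℝ)) : ℝ :=
  2 * quadForm (fun x => x) (gramOff q.1) q.2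
    + (quadForm (fun x => x ^ 2) offDiag q.2 - p * (p - 1))

lemma memLp_quadForm_gramOff (hx : MemLp (fun x : ℝ => x) 4 μ) :
    MemLp (fun q : (Fin n → Fin p → ℝ) × (Fin p → ℝ) =>
      quadForm (fun x => x) (gramOff q.1) q.2) 2 ((sampleLaw μ n p).prod (iidLaw μ p)) := by
  refine memLp_finsetSum _ fun i _ => memLp_finsetSum _ fun j _ => ?_
  by_cases hij : i = j
  · simp [hij, gramOff_self]
  · exact MemLp.prod_mul (k := 2) two_ne_zero (memLp_gramOff hx i j).two_of_four
      (memLp_mul_eval (k := 2) two_ne_zero hx.two_of_four hij)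

lemma memLp_gramSqIncr (hx : MemLp (fun x : ℝ => x) 4 μ) :
    MemLp (gramSqIncr : (Fin n → Fin p → ℝ) × (Fin p → ℝ) → ℝ) 2
      ((sampleLaw μ n p).prod (iidLaw μ p)) :=
  ((memLp_quadForm_gramOff hx).const_mul 2).add
    (((memLp_colSq hx).sub (memLp_const _)).comp_prod_snd)

lemma integral_gramSqIncr (hx : MemLp (fun x : ℝ => x) 4 μ) (h1 : ∫ x, x ∂μ = 0)
    (h2 : ∫ x, x ^ 2 ∂μ = 1) (z : Fin n → Fin p → ℝ) :
    ∫ w, gramSqIncr (z, w) ∂(iidLaw μ p) = 0 := by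
  have hQ := memLp_quadForm (k := 2) two_ne_zero hx.two_of_four (gramOff_self z)
  have hC : Integrable (fun w : Fin p → ℝ => quadForm (fun x => x ^ 2) offDiag w - p * (p - 1))
      (iidLaw μ p) := (memLp_colSq hx).one_of_two.sub (integrable_const _)
  simp only [gramSqIncr]
  rw [integral_add (hQ.one_of_two.const_mul 2) hC, integral_const_mul,
    integral_quadForm hx.two_of_four.one_of_two h1 (gramOff_self z), integral_colSq_sub hx h2]
  simp

lemma gramSq_sub_snoc (z : Fin n → Fin p → ℝ) (w : Fin p → ℝ) :
    gramSq (Fin.snoc z w : Fin (n + 1) → Fin p → ℝ) - (n + 1 : ℕ) * (p * (p - 1)) =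
      (gramSq z - n * (p * (p - 1))) + gramSqIncr (z, w) := by
  rw [gramSq_snoc, gramSqIncr]
  push_cast
  ring

lemma integral_gramSq_sub (hx : MemLp (fun x : ℝ => x) 4 μ) (h1 : ∫ x, x ∂μ = 0)
    (h2 : ∫ x, x ^ 2 ∂μ = 1) :
    ∫ z : Fin n → Fin p → ℝ, (gramSq z - n * (p * (p - 1))) ∂(sampleLaw μ n p) = 0 := by
  induction n with
  | zero => simp [gramSq, gramOff]
  | succ n ih =>
    rw [integral_iidLaw_succ]
    simp only [gramSq_sub_snoc, Prod.mk.eta]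
    have hF : Integrable (fun z : Fin n → Fin p → ℝ => gramSq z - n * (p * (p - 1)))
      (sampleLaw μ n p) := (memLp_gramSq hx).one_of_two.sub (integrable_const _)
    have hD := (memLp_gramSqIncr (n := n) (p := p) hx).one_of_two
    rw [integral_add (hF.comp_fst _) hD, integral_prod _ hD,
      integral_fun_fst (fun z : Fin n → Fin p → ℝ => gramSq z - n * (p * (p - 1))), ih]
    simp [integral_gramSqIncr hx h1 h2]

lemma integral_gramSq (hx : MemLp (fun x : ℝ => x) 4 μ) (h1 : ∫ x, x ∂μ = 0)
    (h2 : ∫ x, x ^ 2 ∂μ = 1) :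
    ∫ z : Fin n → Fin p → ℝ, gramSq z ∂(sampleLaw μ n p) = n * (p * (p - 1)) := by
  have h := integral_gramSq_sub (n := n) (p := p) hx h1 h2
  rw [integral_sub (memLp_gramSq hx).one_of_two (integrable_const _)] at h
  simp only [integral_const, probReal_univ, one_smul] at h
  linarith

lemma integral_crossSum (hx : MemLp (fun x : ℝ => x) 4 μ) (h1 : ∫ x, x ∂μ = 0)
    (h2 : ∫ x, x ^ 2 ∂μ = 1) :
    ∫ z : Fin n → Fin p → ℝ, crossSum z ∂(sampleLaw μ n p) = 0 := by
  have hc := memLp_colSq (p := p) hx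
  unfold crossSum
  rw [integral_sub (memLp_gramSq hx).one_of_two
    (integrable_finsetSum _ fun t _ => (hc.comp_eval n t).one_of_two), integral_gramSq hx h1 h2,
    integral_finsetSum _ fun t _ => (hc.comp_eval n t).one_of_two]
  simp only [fun t : Fin n => integral_comp_eval (μ := fun _ : Fin n => iidLaw μ p) (i := t) hc.1,
    integral_colSq hx h2]
  simp

lemma integral_quadForm_gramOff_sq (hx : MemLp (fun x : ℝ => x) 4 μ) (h1 : ∫ x, x ∂μ = 0)
    (h2 : ∫ x, x ^ 2 ∂μ = 1) (z : Fin n → Fin p → ℝ) :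
    ∫ w, quadForm (fun x => x) (gramOff z) w ^ 2 ∂(iidLaw μ p) = 2 * gramSq z := by
  rw [integral_quadForm_sq hx.two_of_four h1 (gramOff_symm z) (gramOff_self z), h2, gramSq]
  ring

/-- The sum of squared off-diagonal Gram entries concentrates around its mean, which is of order
`n p²`, with fluctuations of order `n p + √(n p³)`. -/
lemma integral_gramSq_sub_sq_le (hx : MemLp (fun x : ℝ => x) 4 μ) (h1 : ∫ x, x ∂μ = 0)
    (h2 : ∫ x, x ^ 2 ∂μ = 1) :
    ∫ z : Fin n → Fin p → ℝ, (gramSq z - n * (p * (p - 1))) ^ 2 ∂(sampleLaw μ n p) ≤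
      16 * (n : ℝ) ^ 2 * (p : ℝ) ^ 2
        + 2 * (n : ℝ) * (4 * (∫ x, (x ^ 2 - 1) ^ 2 ∂μ) ^ 2 * (p : ℝ) ^ 2
          + 8 * (∫ x, (x ^ 2 - 1) ^ 2 ∂μ) * (p : ℝ) ^ 3) := by
  induction n with
  | zero => simp [gramSq, gramOff]
  | succ n ih =>
    rw [integral_iidLaw_succ]
    simp only [gramSq_sub_snoc, Prod.mk.eta]
    have hF : MemLp (fun z : Fin n → Fin p → ℝ => gramSq z - n * (p * (p - 1))) 2
      (sampleLaw μ n p) := (memLp_gramSq hx).sub (memLp_const _)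
    have hD := memLp_gramSqIncr (n := n) (p := p) hx
    rw [integral_add_increment_sq hF hD (integral_gramSqIncr hx h1 h2)]
    have hV := integral_colSq_sub_sq_le (p := p) hx h2
    set V := 4 * (∫ x, (x ^ 2 - 1) ^ 2 ∂μ) ^ 2 * (p : ℝ) ^ 2
        + 8 * (∫ x, (x ^ 2 - 1) ^ 2 ∂μ) * (p : ℝ) ^ 3
    have hin : ∀ z : Fin n → Fin p → ℝ,
        ∫ w, gramSqIncr (z, w) ^ 2 ∂(iidLaw μ p) ≤ 16 * gramSq z + 2 * V := by
      intro z
      have hQ := memLp_quadForm (k := 2) two_ne_zero hx.two_of_four (gramOff_self z)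
      have hC : MemLp (fun w : Fin p → ℝ => quadForm (fun x => x ^ 2) offDiag w - p * (p - 1)) 2
          (iidLaw μ p) := (memLp_colSq hx).sub (memLp_const _)
      calc _ ≤ ∫ w : Fin p → ℝ, (8 * quadForm (fun x => x) (gramOff z) w ^ 2
            + 2 * (quadForm (fun x => x ^ 2) offDiag w - p * (p - 1)) ^ 2) ∂(iidLaw μ p) := by
            refine integral_mono_of_nonneg (ae_of_all _ fun w => sq_nonneg _)
              ((hQ.integrable_sq.const_mul 8).add (hC.integrable_sq.const_mul 2))
              (ae_of_all _ fun w => ?_)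
            simp only [gramSqIncr]
            nlinarith [sq_nonneg (2 * quadForm (fun x => x) (gramOff z) w -
              (quadForm (fun x => x ^ 2) offDiag w - p * (p - 1)))]
        _ = 8 * (2 * gramSq z) + 2 * ∫ w : Fin p → ℝ,
              (quadForm (fun x => x ^ 2) offDiag w - p * (p - 1)) ^ 2 ∂(iidLaw μ p) := by
            rw [integral_add (hQ.integrable_sq.const_mul 8) (hC.integrable_sq.const_mul 2),
              integral_const_mul, integral_const_mul, integral_quadForm_gramOff_sq hx h1 h2]
        _ ≤ _ := by linarith
    have hout : ∫ z : Fin n → Fin p → ℝ, ∫ w, gramSqIncr (z, w) ^ 2 ∂(iidLaw μ p)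
        ∂(sampleLaw μ n p) ≤ 16 * (n * (p * (p - 1))) + 2 * V := by
      calc _ ≤ ∫ z : Fin n → Fin p → ℝ, (16 * gramSq z + 2 * V) ∂(sampleLaw μ n p) :=
            integral_mono hD.integrable_sq.integral_prod_left
              (((memLp_gramSq hx).one_of_two.const_mul 16).add (integrable_const _)) hin
        _ = _ := by
            rw [integral_add ((memLp_gramSq hx).one_of_two.const_mul 16) (integrable_const _),
              integral_const_mul, integral_gramSq hx h1 h2]
            simp
    have hp : (p : ℝ) * (p - 1) ≤ p ^ 2 := by nlinarith [(Nat.cast_nonneg p : (0 : ℝ) ≤ p)]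
    have hn : (n : ℝ) * (p * (p - 1)) ≤ n * p ^ 2 := by gcongr
    push_cast
    nlinarith [sq_nonneg (p : ℝ), mul_nonneg (Nat.cast_nonneg n : (0 : ℝ) ≤ n) (sq_nonneg (p : ℝ))]

end Gram

/-! ### Comparison of characteristic functions for one increment -/

section CharFun

lemma norm_exp_mul_I_sub_taylor_le (x : ℝ) :
    ‖Complex.exp (x * Complex.I) - (1 + x * Complex.I - (x : ℂ) ^ 2 / 2)‖ ≤ 4 * |x| ^ 3 := by
  have hn : ‖(x * Complex.I : ℂ)‖ = |x| := by simp
  rcases le_total |x| 1 with h | h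
  · have := Complex.exp_bound (x := x * Complex.I) (by rw [hn]; exact h) (n := 3) (by norm_num)
    rw [hn] at this
    have e : ∑ m ∈ Finset.range 3, (x * Complex.I : ℂ) ^ m / (m.factorial : ℂ) =
        1 + x * Complex.I - (x : ℂ) ^ 2 / 2 := by
      simp [Finset.sum_range_succ, Nat.factorial, mul_pow]
      ring
    rw [e] at this
    refine this.trans ?_
    rw [mul_comm]
    have h3 : 0 ≤ |x| ^ 3 := by positivity
    norm_num [Nat.factorial]
    nlinarith
  · have h1 : ‖Complex.exp (x * Complex.I)‖ = 1 := Complex.norm_exp_ofReal_mul_I x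
    have h2 : ‖(1 + x * Complex.I - (x : ℂ) ^ 2 / 2 : ℂ)‖ ≤ 1 + |x| + |x| ^ 2 / 2 := by
      refine (norm_sub_le _ _).trans (add_le_add ((norm_add_le _ _).trans ?_) ?_)
      · simp
      · simp
    refine (norm_sub_le _ _).trans ?_
    have h3 : |x| ≤ |x| ^ 2 := by nlinarith
    have h4 : |x| ^ 2 ≤ |x| ^ 3 := by nlinarith
    nlinarith

lemma abs_exp_neg_sub_le {a : ℝ} (ha : 0 ≤ a) : |Real.exp (-a) - (1 - a)| ≤ a ^ 2 := by
  have h1 := Real.add_one_le_exp (-a)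
  have h2 := Real.add_one_le_exp a
  have h3 : Real.exp (-a) ≤ 1 - a + a ^ 2 := by
    rw [Real.exp_neg, inv_le_comm₀ (Real.exp_pos a) (by nlinarith)]
    refine le_trans ?_ h2
    rw [inv_le_comm₀ (by nlinarith) (by linarith), inv_le_iff_one_le_mul₀ (by linarith)]
    nlinarith [pow_nonneg ha 3]
  rw [abs_le]
  constructor <;> nlinarith [sq_nonneg a]

lemma integrable_exp_mul_I {Z : Type*} [MeasurableSpace Z] {ρ : Measure Z} [IsProbabilityMeasure ρ]
    {f : Z → ℝ} (hf : AEStronglyMeasurable f ρ) :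
    Integrable (fun z => Complex.exp (f z * Complex.I)) ρ := by
  refine Integrable.of_bound (C := 1) ?_ (ae_of_all _ fun z => ?_)
  · exact (by fun_prop : Continuous fun x : ℝ => Complex.exp (x * Complex.I)
      ).comp_aestronglyMeasurable hf
  · rw [Complex.norm_exp_ofReal_mul_I]

lemma norm_exp_mul_I_sub_le (x y : ℝ) :
    ‖Complex.exp (x * Complex.I) - Complex.exp (y * Complex.I)‖ ≤ |x - y| := by
  have e : Complex.exp (x * Complex.I) - Complex.exp (y * Complex.I) =
      Complex.exp (y * Complex.I) * (Complex.exp (Complex.I * ((x - y : ℝ) : ℂ)) - 1) := by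
    rw [mul_sub, ← Complex.exp_add, mul_one]
    congr 2
    push_cast
    ring
  rw [e, norm_mul, Complex.norm_exp_ofReal_mul_I, one_mul]
  exact Real.norm_exp_I_mul_ofReal_sub_one_le

lemma norm_integral_exp_sub_le {Z : Type*} [MeasurableSpace Z] {ρ : Measure Z}
    [IsProbabilityMeasure ρ] {f g : Z → ℝ} (hf : Integrable f ρ) (hg : Integrable g ρ) :
    ‖∫ z, Complex.exp (f z * Complex.I) ∂ρ - ∫ z, Complex.exp (g z * Complex.I) ∂ρ‖ ≤
      ∫ z, |f z - g z| ∂ρ := by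
  rw [← integral_sub (integrable_exp_mul_I hf.1) (integrable_exp_mul_I hg.1)]
  exact norm_integral_le_of_norm_le (hf.sub hg).abs
    (ae_of_all _ fun z => norm_exp_mul_I_sub_le _ _)

/-- Quantitative comparison of the characteristic function of a centred variable with that of a
Gaussian variable of variance `v`. The third absolute moment is bounded by `(δ E D² + E D⁴ / δ) / 2`
with a free parameter `δ`. -/
lemma norm_integral_exp_sub_gaussian_le {Z : Type*} [MeasurableSpace Z] {ρ : Measure Z}
    [IsProbabilityMeasure ρ] {D : Z → ℝ} (hD : MemLp D 4 ρ) (h0 : ∫ z, D z ∂ρ = 0) (u : ℝ)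
    {v δ : ℝ} (hv : 0 ≤ v) (hδ : 0 < δ) :
    ‖∫ z, Complex.exp ((u * D z : ℝ) * Complex.I) ∂ρ - Real.exp (-(u ^ 2 * v / 2))‖ ≤
      u ^ 2 / 2 * |∫ z, D z ^ 2 ∂ρ - v|
        + 2 * |u| ^ 3 * (δ * ∫ z, D z ^ 2 ∂ρ + (∫ z, D z ^ 4 ∂ρ) / δ) + u ^ 4 * v ^ 2 / 4 := by
  have iD := hD.two_of_four.one_of_two
  have iD2 := hD.two_of_four.integrable_sq
  have iD4 := hD.integrable_pow_four
  have iE := integrable_exp_mul_I (hD.1.const_mul u)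
  set s := ∫ z, D z ^ 2 ∂ρ
  have iT : Integrable (fun z => ((1 : ℂ) + (u * D z : ℝ) * Complex.I
      - (((u * D z) ^ 2 / 2 : ℝ) : ℂ))) ρ := by
    refine Integrable.sub ((integrable_const _).add ?_) ?_
    · exact ((iD.const_mul u).ofReal).mul_const _
    · refine Integrable.ofReal ?_
      simp only [mul_pow]
      exact (iD2.const_mul _).div_const 2
  have eT : ∫ z, ((1 : ℂ) + (u * D z : ℝ) * Complex.I - (((u * D z) ^ 2 / 2 : ℝ) : ℂ)) ∂ρ =
      ((1 - u ^ 2 * s / 2 : ℝ) : ℂ) := by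
    have j1 : Integrable (fun z => ((u * D z : ℝ) : ℂ) * Complex.I) ρ :=
      ((iD.const_mul u).ofReal).mul_const _
    have j2 : Integrable (fun z => (((u * D z) ^ 2 / 2 : ℝ) : ℂ)) ρ := by
      refine Integrable.ofReal ?_
      simp only [mul_pow]
      exact (iD2.const_mul _).div_const 2
    have j3 : Integrable (fun z => (1 : ℂ) + ((u * D z : ℝ) : ℂ) * Complex.I) ρ :=
      (integrable_const _).add j1
    rw [integral_sub j3 j2, integral_add (integrable_const _) j1, integral_mul_const,
      integral_complex_ofReal, integral_complex_ofReal, integral_const_mul, h0, integral_div]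
    simp only [mul_pow, integral_const_mul]
    simp [s]
  have hrem : ‖∫ z, Complex.exp ((u * D z : ℝ) * Complex.I) ∂ρ - ((1 - u ^ 2 * s / 2 : ℝ) : ℂ)‖ ≤
      2 * |u| ^ 3 * (δ * s + (∫ z, D z ^ 4 ∂ρ) / δ) := by
    rw [← eT, ← integral_sub iE iT]
    calc _ ≤ ∫ z, 2 * |u| ^ 3 * (δ * D z ^ 2 + D z ^ 4 / δ) ∂ρ := by
          refine norm_integral_le_of_norm_le
            (((iD2.const_mul δ).add (iD4.div_const δ)).const_mul _) (ae_of_all _ fun z => ?_)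
          have h := norm_exp_mul_I_sub_taylor_le (u * D z)
          have e : (((u * D z) ^ 2 / 2 : ℝ) : ℂ) = (((u * D z : ℝ) : ℂ)) ^ 2 / 2 := by
            push_cast; ring
          rw [e]
          refine h.trans ?_
          rw [abs_mul, mul_pow]
          have hcube : 2 * |D z| ^ 3 ≤ δ * D z ^ 2 + D z ^ 4 / δ := by
            rw [← sq_abs (D z), ← (show Even 4 by decide).pow_abs (D z)]
            have : δ * |D z| ^ 2 + |D z| ^ 4 / δ - 2 * |D z| ^ 3 =
                |D z| ^ 2 * (δ - |D z|) ^ 2 / δ := by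
              field_simp
              ring
            have h' : 0 ≤ |D z| ^ 2 * (δ - |D z|) ^ 2 / δ := by positivity
            linarith
          have h3 : 0 ≤ |u| ^ 3 := by positivity
          nlinarith
      _ = _ := by
          rw [integral_const_mul, integral_add (iD2.const_mul δ) (iD4.div_const δ),
            integral_const_mul, integral_div]
  have ha : 0 ≤ u ^ 2 * v / 2 := by positivity
  have hexp := abs_exp_neg_sub_le ha
  have hreal : ‖((1 - u ^ 2 * s / 2 : ℝ) : ℂ) - (Real.exp (-(u ^ 2 * v / 2)) : ℂ)‖ ≤
      u ^ 2 / 2 * |s - v| + u ^ 4 * v ^ 2 / 4 := by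
    rw [← Complex.ofReal_sub, Complex.norm_real, Real.norm_eq_abs]
    have e : 1 - u ^ 2 * s / 2 - Real.exp (-(u ^ 2 * v / 2)) =
        -(u ^ 2 / 2 * (s - v)) + -(Real.exp (-(u ^ 2 * v / 2)) - (1 - u ^ 2 * v / 2)) := by ring
    rw [e]
    refine (abs_add_le _ _).trans ?_
    rw [abs_neg, abs_neg, abs_mul, abs_of_nonneg (by positivity : 0 ≤ u ^ 2 / 2)]
    nlinarith
  calc _ = ‖(∫ z, Complex.exp ((u * D z : ℝ) * Complex.I) ∂ρ - ((1 - u ^ 2 * s / 2 : ℝ) : ℂ))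
        + (((1 - u ^ 2 * s / 2 : ℝ) : ℂ) - (Real.exp (-(u ^ 2 * v / 2)) : ℂ))‖ := by
        congr 1; ring
    _ ≤ _ := (norm_add_le _ _).trans (by linarith)

end CharFun

section Increment

variable {E : Type*} [MeasurableSpace E] {ν : Measure E} [IsProbabilityMeasure ν] {ξ ζ : E → ℝ}

/-- Linear and off-diagonal quadratic forms in independent centred variables are uncorrelated, also
when `ζ` and `ξ` themselves are correlated. -/
lemma integral_linForm_mul_quadForm {n : ℕ} (a : Fin n → ℝ) {A : Fin n → Fin n → ℝ}
    (hζ : MemLp ζ 2 ν) (hξ : MemLp ξ 2 ν) (hζ0 : ∫ e, ζ e ∂ν = 0) (hξ0 : ∫ e, ξ e ∂ν = 0)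
    (hs : ∀ i j, A i j = A j i) (hd : ∀ i, A i i = 0) :
    ∫ z, linForm ζ a z * quadForm ξ A z ∂(iidLaw ν n) = 0 := by
  induction n with
  | zero => simp [linForm]
  | succ n ih =>
    rw [integral_iidLaw_succ]
    simp only [linForm_snoc, quadForm_snoc hs hd]
    have hL := memLp_linForm (fun i : Fin n => a i.castSucc) hζ
    have hQ : MemLp (quadForm ξ fun i j : Fin n => A i.castSucc j.castSucc) 2 (iidLaw ν n) :=
      memLp_quadForm (k := 2) two_ne_zero hξ (fun i => hd _)
    have hl := memLp_linForm (fun i : Fin n => A i.castSucc (Fin.last n)) hξ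
    have e : ∀ q : (Fin n → E) × E,
        (linForm ζ (fun i : Fin n => a i.castSucc) q.1 + a (Fin.last n) * ζ q.2) *
          (quadForm ξ (fun i j : Fin n => A i.castSucc j.castSucc) q.1 +
            2 * linForm ξ (fun i : Fin n => A i.castSucc (Fin.last n)) q.1 * ξ q.2) =
        linForm ζ (fun i : Fin n => a i.castSucc) q.1 *
            quadForm ξ (fun i j : Fin n => A i.castSucc j.castSucc) q.1
          + (2 * (linForm ζ (fun i : Fin n => a i.castSucc) q.1 *
              linForm ξ (fun i : Fin n => A i.castSucc (Fin.last n)) q.1)) * ξ q.2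
          + (a (Fin.last n) * quadForm ξ (fun i j : Fin n => A i.castSucc j.castSucc) q.1) * ζ q.2
          + (2 * a (Fin.last n) * linForm ξ (fun i : Fin n => A i.castSucc (Fin.last n)) q.1) *
              (ζ q.2 * ξ q.2) := fun q => by ring
    simp_rw [e]
    have i0 : Integrable (fun z => linForm ζ (fun i : Fin n => a i.castSucc) z *
        quadForm ξ (fun i j : Fin n => A i.castSucc j.castSucc) z) (iidLaw ν n) :=
      hL.integrable_mul hQ
    have i1 : Integrable (fun z => 2 * (linForm ζ (fun i : Fin n => a i.castSucc) z *
        linForm ξ (fun i : Fin n => A i.castSucc (Fin.last n)) z)) (iidLaw ν n) :=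
      (hL.integrable_mul hl).const_mul 2
    have i2 : Integrable (fun z => a (Fin.last n) *
        quadForm ξ (fun i j : Fin n => A i.castSucc j.castSucc) z) (iidLaw ν n) :=
      hQ.one_of_two.const_mul _
    have i3 : Integrable (fun z => 2 * a (Fin.last n) *
        linForm ξ (fun i : Fin n => A i.castSucc (Fin.last n)) z) (iidLaw ν n) :=
      hl.one_of_two.const_mul _
    have iζξ : Integrable (fun e => ζ e * ξ e) ν := hζ.integrable_mul hξ
    rw [integral_add_four (i0.comp_fst ν) (i1.mul_prod hξ.one_of_two) (i2.mul_prod hζ.one_of_two)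
      (i3.mul_prod iζξ)]
    rw [integral_fun_fst (fun z => linForm ζ (fun i : Fin n => a i.castSucc) z *
        quadForm ξ (fun i j : Fin n => A i.castSucc j.castSucc) z),
      ih _ (fun i j => hs _ _) (fun i => hd _),
      integral_prod_mul (fun z => 2 * (linForm ζ (fun i : Fin n => a i.castSucc) z *
        linForm ξ (fun i : Fin n => A i.castSucc (Fin.last n)) z)) ξ, hξ0,
      integral_prod_mul (fun z => a (Fin.last n) *
        quadForm ξ (fun i j : Fin n => A i.castSucc j.castSucc) z) ζ, hζ0,
      integral_prod_mul (fun z => 2 * a (Fin.last n) *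
        linForm ξ (fun i : Fin n => A i.castSucc (Fin.last n)) z) (fun e => ζ e * ξ e),
      integral_const_mul (2 * a (Fin.last n)), integral_linForm _ hξ.one_of_two hξ0]
    simp

end Increment

/-! ### The martingale part of the statistic -/

/-- The statistic `α ∑ g(z_{ti}) + β ∑ z_{si} z_{sj} z_{ti} z_{tj}`, a martingale in the number of
observations. -/
def mart {n p : ℕ} (g : ℝ → ℝ) (α β : ℝ) (z : Fin n → Fin p → ℝ) : ℝ :=
  α * entrySum g z + β * crossSum z

/-- The increment of `mart` when the observation `w` is appended to `z`. -/
def martIncr {n p : ℕ} (g : ℝ → ℝ) (α β : ℝ) (z : Fin n → Fin p → ℝ) (w : Fin p → ℝ) : ℝ :=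
  α * linForm g (fun _ => 1) w + 2 * β * quadForm (fun x => x) (gramOff z) w

lemma mart_snoc {n p : ℕ} (g : ℝ → ℝ) (α β : ℝ) (z : Fin n → Fin p → ℝ) (w : Fin p → ℝ) :
    mart g α β (Fin.snoc z w : Fin (n + 1) → Fin p → ℝ) =
      mart g α β z + martIncr g α β z w := by
  simp only [mart, martIncr, entrySum_snoc, crossSum_snoc, linForm, one_mul]
  ring

/-- The expected conditional variance of an increment of `mart`, after `n` observations. -/
noncomputable def incrVar (μ : Measure ℝ) (g : ℝ → ℝ) (α β : ℝ) (n p : ℕ) : ℝ :=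
  α ^ 2 * p * (∫ x, g x ^ 2 ∂μ) + 8 * β ^ 2 * (n * (p * (p - 1)))

/-- A bound for the variance of `gramSq`. -/
noncomputable def gramVar (μ : Measure ℝ) (n p : ℕ) : ℝ :=
  16 * (n : ℝ) ^ 2 * (p : ℝ) ^ 2
    + 2 * (n : ℝ) * (4 * (∫ x, (x ^ 2 - 1) ^ 2 ∂μ) ^ 2 * (p : ℝ) ^ 2
      + 8 * (∫ x, (x ^ 2 - 1) ^ 2 ∂μ) * (p : ℝ) ^ 3)

lemma natCast_mul_sub_one_nonneg (p : ℕ) : (0 : ℝ) ≤ p * (p - 1) := by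
  rcases Nat.eq_zero_or_pos p with rfl | h
  · simp
  · have : (1 : ℝ) ≤ p := by exact_mod_cast h
    exact mul_nonneg (by linarith) (by linarith)

lemma incrVar_nonneg (μ : Measure ℝ) (g : ℝ → ℝ) (n p : ℕ) (α β : ℝ) :
    0 ≤ incrVar μ g α β n p := by
  have h1 : 0 ≤ ∫ x, g x ^ 2 ∂μ := integral_nonneg fun x => sq_nonneg _
  have := natCast_mul_sub_one_nonneg p
  unfold incrVar
  positivity

section Martingale

variable {μ : Measure ℝ} [IsProbabilityMeasure μ] {n p : ℕ} {g : ℝ → ℝ}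

lemma memLp_martIncr (hx : MemLp (fun x : ℝ => x) 4 μ) (hg : MemLp g 4 μ) (α β : ℝ)
    (z : Fin n → Fin p → ℝ) : MemLp (martIncr g α β z) 4 (iidLaw μ p) :=
  ((memLp_linForm _ hg).const_mul α).add
    ((memLp_quadForm (k := 4) (by norm_num) hx (gramOff_self z)).const_mul (2 * β))

lemma integral_martIncr (hx : MemLp (fun x : ℝ => x) 4 μ) (h1 : ∫ x, x ∂μ = 0)
    (hg : MemLp g 4 μ) (hg0 : ∫ x, g x ∂μ = 0) (α β : ℝ) (z : Fin n → Fin p → ℝ) :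
    ∫ w, martIncr g α β z w ∂(iidLaw μ p) = 0 := by
  unfold martIncr
  rw [integral_add ((memLp_linForm _ hg).two_of_four.one_of_two.const_mul α)
    ((memLp_quadForm (k := 4) (by norm_num) hx (gramOff_self z)).two_of_four.one_of_two.const_mul _),
    integral_const_mul, integral_const_mul, integral_linForm _ hg.two_of_four.one_of_two hg0,
    integral_quadForm hx.two_of_four.one_of_two h1 (gramOff_self z)]
  simp

lemma integral_martIncr_sq (hx : MemLp (fun x : ℝ => x) 4 μ) (h1 : ∫ x, x ∂μ = 0)
    (h2 : ∫ x, x ^ 2 ∂μ = 1) (hg : MemLp g 4 μ) (hg0 : ∫ x, g x ∂μ = 0) (α β : ℝ)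
    (z : Fin n → Fin p → ℝ) :
    ∫ w, martIncr g α β z w ^ 2 ∂(iidLaw μ p) =
      α ^ 2 * p * (∫ x, g x ^ 2 ∂μ) + 8 * β ^ 2 * gramSq z := by
  have hL : MemLp (linForm g fun _ : Fin p => (1 : ℝ)) 2 (iidLaw μ p) :=
    memLp_linForm _ hg.two_of_four
  have hQ : MemLp (quadForm (fun x => x) (gramOff z)) 2 (iidLaw μ p) :=
    memLp_quadForm (k := 2) two_ne_zero hx.two_of_four (gramOff_self z)
  have hLQ : Integrable (fun w => linForm g (fun _ : Fin p => (1 : ℝ)) w *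
      quadForm (fun x => x) (gramOff z) w) (iidLaw μ p) := hL.integrable_mul hQ
  have e : ∀ w, martIncr g α β z w ^ 2 = α ^ 2 * linForm g (fun _ => 1) w ^ 2 +
      4 * α * β * (linForm g (fun _ => 1) w * quadForm (fun x => x) (gramOff z) w) +
      4 * β ^ 2 * quadForm (fun x => x) (gramOff z) w ^ 2 := fun w => by
    unfold martIncr; ring
  simp_rw [e]
  rw [integral_add_three (hL.integrable_sq.const_mul _) (hLQ.const_mul _)
    (hQ.integrable_sq.const_mul _), integral_const_mul, integral_const_mul, integral_const_mul,
    integral_linForm_sq _ hg.two_of_four hg0, integral_quadForm_gramOff_sq hx h1 h2,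
    integral_linForm_mul_quadForm _ hg.two_of_four hx.two_of_four hg0 h1 (gramOff_symm z)
      (gramOff_self z)]
  simp
  ring

lemma integral_martIncr_pow_four_le (hx : MemLp (fun x : ℝ => x) 4 μ) (h1 : ∫ x, x ∂μ = 0)
    (hg : MemLp g 4 μ) (hg0 : ∫ x, g x ∂μ = 0) (α β : ℝ) (z : Fin n → Fin p → ℝ) :
    ∫ w, martIncr g α β z w ^ 4 ∂(iidLaw μ p) ≤
      32 * α ^ 4 * p ^ 2 * (∫ x, g x ^ 4 ∂μ)
        + 32768 * β ^ 4 * (∫ x, x ^ 4 ∂μ) ^ 2 * gramSq z ^ 2 := by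
  have hL : MemLp (linForm g fun _ : Fin p => (1 : ℝ)) 4 (iidLaw μ p) := memLp_linForm _ hg
  have hQ : MemLp (quadForm (fun x => x) (gramOff z)) 4 (iidLaw μ p) :=
    memLp_quadForm (k := 4) (by norm_num) hx (gramOff_self z)
  have b1 := integral_linForm_pow_four_le (fun _ : Fin p => (1 : ℝ)) hg hg0
  have b2 := integral_quadForm_pow_four_le hx h1 (gramOff_symm z) (gramOff_self z)
  calc _ ≤ ∫ w, (8 * α ^ 4 * linForm g (fun _ => 1) w ^ 4 +
        128 * β ^ 4 * quadForm (fun x => x) (gramOff z) w ^ 4) ∂(iidLaw μ p) := by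
        refine integral_mono (memLp_martIncr hx hg α β z).integrable_pow_four
          ((hL.integrable_pow_four.const_mul _).add (hQ.integrable_pow_four.const_mul _))
          fun w => ?_
        have h : ∀ a b : ℝ, (a + b) ^ 4 ≤ 8 * (a ^ 4 + b ^ 4) := fun a b => by
          nlinarith [sq_nonneg (a - b), sq_nonneg (a ^ 2 - b ^ 2), sq_nonneg (a + b),
            sq_nonneg (a * b), mul_nonneg (sq_nonneg (a - b)) (sq_nonneg (a + b)),
            mul_nonneg (sq_nonneg (a - b)) (sq_nonneg (a - b))]
        have := h (α * linForm g (fun _ => 1) w) (2 * β * quadForm (fun x => x) (gramOff z) w)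
        unfold martIncr
        simp only
        nlinarith
    _ = 8 * α ^ 4 * ∫ w, linForm g (fun _ : Fin p => (1 : ℝ)) w ^ 4 ∂(iidLaw μ p) +
        128 * β ^ 4 * ∫ w, quadForm (fun x => x) (gramOff z) w ^ 4 ∂(iidLaw μ p) := by
        rw [integral_add (hL.integrable_pow_four.const_mul _)
          (hQ.integrable_pow_four.const_mul _), integral_const_mul, integral_const_mul]
    _ ≤ 8 * α ^ 4 * (4 * (∫ x, g x ^ 4 ∂μ) * (∑ i : Fin p, (1 : ℝ) ^ 2) ^ 2) +
        128 * β ^ 4 * (256 * (∫ x, x ^ 4 ∂μ) ^ 2 * gramSq z ^ 2) := by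
        gcongr
        exact b2
    _ = _ := by
        simp
        ring

lemma memLp_mart (hx : MemLp (fun x : ℝ => x) 4 μ) (hg : MemLp g 4 μ) (α β : ℝ) :
    MemLp (mart g α β : (Fin n → Fin p → ℝ) → ℝ) 2 (sampleLaw μ n p) :=
  ((memLp_entrySum hg.two_of_four).const_mul α).add ((memLp_crossSum hx).const_mul β)

lemma integral_gramSq_sq_le (hx : MemLp (fun x : ℝ => x) 4 μ) (h1 : ∫ x, x ∂μ = 0)
    (h2 : ∫ x, x ^ 2 ∂μ = 1) :
    ∫ z : Fin n → Fin p → ℝ, gramSq z ^ 2 ∂(sampleLaw μ n p) ≤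
      gramVar μ n p + (n : ℝ) ^ 2 * (p : ℝ) ^ 4 := by
  have hv := integral_gramSq_sub_sq_le (n := n) (p := p) hx h1 h2
  have hm := integral_gramSq (n := n) (p := p) hx h1 h2
  have hN : MemLp (gramSq : (Fin n → Fin p → ℝ) → ℝ) 2 (sampleLaw μ n p) := memLp_gramSq hx
  set c : ℝ := n * (p * (p - 1)) with hc
  have e : ∀ z : Fin n → Fin p → ℝ, (gramSq z - c) ^ 2 =
      gramSq z ^ 2 + (-2 * c) * gramSq z + c ^ 2 := fun z => by ring
  simp_rw [e] at hv
  rw [integral_add_three hN.integrable_sq (hN.one_of_two.const_mul _) (integrable_const _),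
    integral_const_mul, hm] at hv
  simp only [integral_const, probReal_univ, one_smul] at hv
  have hc2 : c ^ 2 ≤ (n : ℝ) ^ 2 * (p : ℝ) ^ 4 := by
    have h0 := natCast_mul_sub_one_nonneg p
    have h3 : (p : ℝ) * (p - 1) ≤ p ^ 2 := by nlinarith [(Nat.cast_nonneg p : (0 : ℝ) ≤ p)]
    have h4 := pow_le_pow_left₀ h0 h3 2
    rw [hc, mul_pow]
    have := mul_le_mul_of_nonneg_left h4 (sq_nonneg (n : ℝ))
    nlinarith
  unfold gramVar
  nlinarith

/-- One step of the comparison with the Gaussian characteristic function: appending an observation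
multiplies the characteristic function of `mart` by approximately `exp (-u² v / 2)`, where `v` is
the expected conditional variance of the increment. -/
lemma norm_charFun_mart_succ_sub_le (hx : MemLp (fun x : ℝ => x) 4 μ) (h1 : ∫ x, x ∂μ = 0)
    (h2 : ∫ x, x ^ 2 ∂μ = 1) (hg : MemLp g 4 μ) (hg0 : ∫ x, g x ∂μ = 0) (α β u : ℝ)
    {δ : ℝ} (hδ : 0 < δ) :
    ‖∫ z : Fin (n + 1) → Fin p → ℝ, Complex.exp ((u * mart g α β z : ℝ) * Complex.I)
        ∂(sampleLaw μ (n + 1) p)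
      - Real.exp (-(u ^ 2 * incrVar μ g α β n p / 2)) *
        ∫ z : Fin n → Fin p → ℝ, Complex.exp ((u * mart g α β z : ℝ) * Complex.I)
          ∂(sampleLaw μ n p)‖ ≤
      4 * u ^ 2 * β ^ 2 * √(gramVar μ n p)
        + 2 * |u| ^ 3 * (δ * incrVar μ g α β n p + (32 * α ^ 4 * p ^ 2 * (∫ x, g x ^ 4 ∂μ)
          + 32768 * β ^ 4 * (∫ x, x ^ 4 ∂μ) ^ 2 * (gramVar μ n p + (n : ℝ) ^ 2 * (p : ℝ) ^ 4)) / δ)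
        + u ^ 4 * incrVar μ g α β n p ^ 2 / 4 := by
  set v := incrVar μ g α β n p with hv
  have hv0 : 0 ≤ v := incrVar_nonneg μ g n p α β
  set B := 32 * α ^ 4 * p ^ 2 * (∫ x, g x ^ 4 ∂μ) with hB
  set C := 32768 * β ^ 4 * (∫ x, x ^ 4 ∂μ) ^ 2 with hC
  set c := ∫ x, g x ^ 2 ∂μ with hc
  have hC0 : 0 ≤ C := by positivity
  have hN : MemLp (gramSq : (Fin n → Fin p → ℝ) → ℝ) 2 (sampleLaw μ n p) := memLp_gramSq hx
  have hS1 : AEStronglyMeasurable (mart g α β : (Fin (n + 1) → Fin p → ℝ) → ℝ)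
      (sampleLaw μ (n + 1) p) := (memLp_mart hx hg α β).1
  have hS : AEStronglyMeasurable (mart g α β : (Fin n → Fin p → ℝ) → ℝ)
      (sampleLaw μ n p) := (memLp_mart hx hg α β).1
  have iS := integrable_exp_mul_I (hS.const_mul u)
  have iS1 := integrable_exp_mul_I (hS1.const_mul u)
  have iq : Integrable (fun q : (Fin n → Fin p → ℝ) × (Fin p → ℝ) => Complex.exp
      ((u * mart g α β (Fin.snoc q.1 q.2 : Fin (n + 1) → Fin p → ℝ) : ℝ) * Complex.I))
      ((sampleLaw μ n p).prod (iidLaw μ p)) := by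
    have := ((measurePreserving_snocEquiv (ν := iidLaw μ p) n).integrable_comp_emb
      (snocEquiv _ n).measurableEmbedding).2 iS1
    refine this.congr (ae_of_all _ fun q => ?_)
    simp only [Function.comp, snocEquiv_apply]
  have hsplit : ∫ z : Fin (n + 1) → Fin p → ℝ, Complex.exp ((u * mart g α β z : ℝ) * Complex.I)
        ∂(sampleLaw μ (n + 1) p) =
      ∫ z : Fin n → Fin p → ℝ, Complex.exp ((u * mart g α β z : ℝ) * Complex.I) *
        ∫ w, Complex.exp ((u * martIncr g α β z w : ℝ) * Complex.I) ∂(iidLaw μ p)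
          ∂(sampleLaw μ n p) := by
    rw [integral_iidLaw_succ, integral_prod _ iq]
    refine integral_congr_ae (ae_of_all _ fun z => ?_)
    simp only
    rw [← integral_const_mul]
    refine integral_congr_ae (ae_of_all _ fun w => ?_)
    simp only
    rw [mart_snoc, ← Complex.exp_add]
    congr 1
    push_cast
    ring
  have iprod : Integrable (fun z : Fin n → Fin p → ℝ =>
      Complex.exp ((u * mart g α β z : ℝ) * Complex.I) *
        ∫ w, Complex.exp ((u * martIncr g α β z w : ℝ) * Complex.I) ∂(iidLaw μ p))
      (sampleLaw μ n p) := by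
    refine iq.integral_prod_left.congr (ae_of_all _ fun z => ?_)
    simp only
    rw [← integral_const_mul]
    refine integral_congr_ae (ae_of_all _ fun w => ?_)
    simp only
    rw [mart_snoc, ← Complex.exp_add]
    congr 1
    push_cast
    ring
  rw [hsplit, ← integral_const_mul, ← integral_sub iprod (iS.const_mul _)]
  have iN1 : Integrable (fun z : Fin n → Fin p → ℝ => |gramSq z - n * (p * (p - 1))|)
      (sampleLaw μ n p) := (hN.one_of_two.sub (integrable_const _)).abs
  have iH1 : Integrable (fun z : Fin n → Fin p → ℝ => 4 * u ^ 2 * β ^ 2 *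
      |gramSq z - n * (p * (p - 1))|) (sampleLaw μ n p) := iN1.const_mul _
  have iH2 : Integrable (fun z : Fin n → Fin p → ℝ =>
      2 * |u| ^ 3 * δ * 8 * β ^ 2 * gramSq z) (sampleLaw μ n p) := hN.one_of_two.const_mul _
  have iH3 : Integrable (fun z : Fin n → Fin p → ℝ =>
      2 * |u| ^ 3 / δ * C * gramSq z ^ 2) (sampleLaw μ n p) := hN.integrable_sq.const_mul _
  have iH4 : Integrable (fun _ : Fin n → Fin p → ℝ => 2 * |u| ^ 3 * (δ * (α ^ 2 * p * c) + B / δ)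
      + u ^ 4 * v ^ 2 / 4) (sampleLaw μ n p) := integrable_const _
  calc _ ≤ ∫ z : Fin n → Fin p → ℝ, (4 * u ^ 2 * β ^ 2 * |gramSq z - n * (p * (p - 1))|
        + 2 * |u| ^ 3 * δ * 8 * β ^ 2 * gramSq z + 2 * |u| ^ 3 / δ * C * gramSq z ^ 2
        + (2 * |u| ^ 3 * (δ * (α ^ 2 * p * c) + B / δ) + u ^ 4 * v ^ 2 / 4))
          ∂(sampleLaw μ n p) := by
        refine norm_integral_le_of_norm_le (((iH1.add iH2).add iH3).add iH4)
          (ae_of_all _ fun z => ?_)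
        have e : Complex.exp ((u * mart g α β z : ℝ) * Complex.I) *
            (∫ w, Complex.exp ((u * martIncr g α β z w : ℝ) * Complex.I) ∂(iidLaw μ p))
            - (Real.exp (-(u ^ 2 * v / 2)) : ℂ) *
              Complex.exp ((u * mart g α β z : ℝ) * Complex.I) =
            Complex.exp ((u * mart g α β z : ℝ) * Complex.I) *
            ((∫ w, Complex.exp ((u * martIncr g α β z w : ℝ) * Complex.I) ∂(iidLaw μ p))
              - (Real.exp (-(u ^ 2 * v / 2)) : ℂ)) := by ring
        rw [e, norm_mul, Complex.norm_exp_ofReal_mul_I, one_mul]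
        refine (norm_integral_exp_sub_gaussian_le (memLp_martIncr hx hg α β z)
          (integral_martIncr hx h1 hg hg0 α β z) u hv0 hδ).trans ?_
        have b4 := integral_martIncr_pow_four_le hx h1 hg hg0 α β z
        rw [integral_martIncr_sq hx h1 h2 hg hg0]
        have es : α ^ 2 * p * c + 8 * β ^ 2 * gramSq z - v =
            8 * β ^ 2 * (gramSq z - n * (p * (p - 1))) := by
          rw [hv, incrVar]; ring
        rw [es, abs_mul, abs_of_nonneg (by positivity : 0 ≤ 8 * β ^ 2)]
        have b5 : (∫ w, martIncr g α β z w ^ 4 ∂(iidLaw μ p)) / δ ≤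
            B / δ + C * gramSq z ^ 2 / δ := by
          rw [← add_div]
          gcongr
        have h3 : 0 ≤ 2 * |u| ^ 3 := by positivity
        have b6 := mul_le_mul_of_nonneg_left b5 h3
        have e2 : 2 * |u| ^ 3 / δ * C * gramSq z ^ 2 =
          2 * |u| ^ 3 * (C * gramSq z ^ 2 / δ) := by ring
        rw [e2]
        linarith
    _ = 4 * u ^ 2 * β ^ 2 * ∫ z : Fin n → Fin p → ℝ, |gramSq z - n * (p * (p - 1))|
          ∂(sampleLaw μ n p)
        + 2 * |u| ^ 3 * δ * 8 * β ^ 2 * (n * (p * (p - 1)))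
        + 2 * |u| ^ 3 / δ * C * ∫ z : Fin n → Fin p → ℝ, gramSq z ^ 2 ∂(sampleLaw μ n p)
        + (2 * |u| ^ 3 * (δ * (α ^ 2 * p * c) + B / δ) + u ^ 4 * v ^ 2 / 4) := by
        rw [integral_add_four iH1 iH2 iH3 iH4, integral_const_mul, integral_const_mul,
          integral_const_mul, integral_gramSq hx h1 h2]
        simp
    _ ≤ 4 * u ^ 2 * β ^ 2 * √(gramVar μ n p)
        + 2 * |u| ^ 3 * δ * 8 * β ^ 2 * (n * (p * (p - 1)))
        + 2 * |u| ^ 3 / δ * C * (gramVar μ n p + (n : ℝ) ^ 2 * (p : ℝ) ^ 4)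
        + (2 * |u| ^ 3 * (δ * (α ^ 2 * p * c) + B / δ) + u ^ 4 * v ^ 2 / 4) := by
        have hA : ∫ z : Fin n → Fin p → ℝ, |gramSq z - n * (p * (p - 1))| ∂(sampleLaw μ n p) ≤
            √(gramVar μ n p) :=
          (integral_abs_le_sqrt (hN.sub (memLp_const _))).trans
            (Real.sqrt_le_sqrt (integral_gramSq_sub_sq_le hx h1 h2))
        have hD := integral_gramSq_sq_le (n := n) (p := p) hx h1 h2
        gcongr
    _ = _ := by
        rw [hv, incrVar]
        ring

end Martingale

/-! ### Telescoping and approximation of entry functions -/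

section Telescope

lemma gramVar_nonneg (μ : Measure ℝ) (n p : ℕ) : 0 ≤ gramVar μ n p := by
  have : 0 ≤ ∫ x, (x ^ 2 - 1) ^ 2 ∂μ := integral_nonneg fun x => sq_nonneg _
  unfold gramVar; positivity

lemma gramVar_mono (μ : Measure ℝ) {k n : ℕ} (h : k ≤ n) (p : ℕ) :
    gramVar μ k p ≤ gramVar μ n p := by
  have : 0 ≤ ∫ x, (x ^ 2 - 1) ^ 2 ∂μ := integral_nonneg fun x => sq_nonneg _
  have hk : (k : ℝ) ≤ n := by exact_mod_cast h
  unfold gramVar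
  gcongr

/-- Telescoping: if the one-step comparison errors are bounded by `b`, the characteristic functions
differ by at most `n b` after `n` steps. -/
lemma norm_sub_exp_le_of_step {Φ : ℕ → ℂ} {v : ℕ → ℝ} {u b : ℝ} {n : ℕ} (h0 : Φ 0 = 1)
    (hv : ∀ k, 0 ≤ v k)
    (hstep : ∀ k < n, ‖Φ (k + 1) - Real.exp (-(u ^ 2 * v k / 2)) * Φ k‖ ≤ b) :
    ‖Φ n - Real.exp (-(u ^ 2 * (∑ k ∈ Finset.range n, v k) / 2))‖ ≤ n * b := by
  induction n with
  | zero => simp [h0]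
  | succ n ih =>
    have ih' := ih fun k hk => hstep k (hk.trans (Nat.lt_succ_self n))
    have hn := hstep n (Nat.lt_succ_self n)
    set c := Real.exp (-(u ^ 2 * v n / 2)) with hc
    have hc1 : c ≤ 1 := Real.exp_le_one_iff.2 (by
      have := mul_nonneg (sq_nonneg u) (hv n)
      linarith)
    have hc0 : 0 ≤ c := (Real.exp_pos _).le
    have e : Φ (n + 1) - (Real.exp (-(u ^ 2 * (∑ k ∈ Finset.range (n + 1), v k) / 2)) : ℂ) =
        (Φ (n + 1) - c * Φ n)
          + c * (Φ n - (Real.exp (-(u ^ 2 * (∑ k ∈ Finset.range n, v k) / 2)) : ℂ)) := by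
      have : Real.exp (-(u ^ 2 * (∑ k ∈ Finset.range (n + 1), v k) / 2)) =
          c * Real.exp (-(u ^ 2 * (∑ k ∈ Finset.range n, v k) / 2)) := by
        rw [hc, ← Real.exp_add, Finset.sum_range_succ]
        congr 1
        ring
      rw [this]
      push_cast
      ring
    rw [e]
    refine (norm_add_le _ _).trans ?_
    rw [norm_mul, Complex.norm_real, Real.norm_eq_abs, abs_of_nonneg hc0]
    have := mul_le_of_le_one_left (norm_nonneg
      (Φ n - (Real.exp (-(u ^ 2 * (∑ k ∈ Finset.range n, v k) / 2)) : ℂ))) hc1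
    push_cast
    push_cast at ih' this hn
    linarith

lemma abs_exp_neg_sub_exp_neg_le {a b : ℝ} (ha : 0 ≤ a) (hb : 0 ≤ b) :
    |Real.exp (-a) - Real.exp (-b)| ≤ |a - b| := by
  have key : ∀ {a b : ℝ}, 0 ≤ a → a ≤ b → |Real.exp (-a) - Real.exp (-b)| ≤ |a - b| := by
    intro a b ha hab
    have h1 : Real.exp (-b) ≤ Real.exp (-a) := Real.exp_le_exp.2 (by linarith)
    have h2 : Real.exp (-a) ≤ 1 := Real.exp_le_one_iff.2 (by linarith)
    have h3 := Real.add_one_le_exp (a - b)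
    have h4 : Real.exp (-b) = Real.exp (-a) * Real.exp (a - b) := by
      rw [← Real.exp_add]; congr 1; ring
    rw [abs_of_nonneg (by linarith), abs_of_nonpos (by linarith), h4]
    nlinarith [Real.exp_pos (-a)]
  rcases le_total a b with h | h
  · exact key ha h
  · rw [abs_sub_comm, abs_sub_comm a]; exact key hb h

lemma sum_incrVar (μ : Measure ℝ) (g : ℝ → ℝ) (α β : ℝ) (n p : ℕ) :
    ∑ k ∈ Finset.range n, incrVar μ g α β k p =
      α ^ 2 * (n * p) * (∫ x, g x ^ 2 ∂μ) + 4 * β ^ 2 * ((n * (n - 1)) * (p * (p - 1))) := by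
  induction n with
  | zero => simp
  | succ n ih =>
    rw [Finset.sum_range_succ, ih, incrVar]
    push_cast
    ring

end Telescope

section Approximation

variable {μ : Measure ℝ} [IsProbabilityMeasure μ]

/-- Centred square-integrable functions can be approximated in `L²` by centred functions in `L⁴`,
with an error relative to their variance; so a vanishing variance forces `g = 0`. -/
lemma exists_memLp_four_approx {f : ℝ → ℝ} (hf : MemLp f 2 μ) (h0 : ∫ x, f x ∂μ = 0) {η : ℝ}
    (hη : 0 < η) (hη1 : η ≤ 1) :
    ∃ g : ℝ → ℝ, ∃ B : ℝ, 0 ≤ B ∧ MemLp g 4 μ ∧ ∫ x, g x ∂μ = 0 ∧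
      ∫ x, (f x - g x) ^ 2 ∂μ ≤ η ^ 2 * ∫ x, f x ^ 2 ∂μ ∧
      |∫ x, g x ^ 2 ∂μ - ∫ x, f x ^ 2 ∂μ| ≤ 3 * η * ∫ x, f x ^ 2 ∂μ ∧
      ∫ x, g x ^ 4 ∂μ ≤ B * (∫ x, f x ^ 2 ∂μ) ^ 2 := by
  have hκ0 : 0 ≤ ∫ x, f x ^ 2 ∂μ := integral_nonneg fun x => sq_nonneg _
  rcases hκ0.eq_or_lt with hκ | hκ
  · refine ⟨fun _ => 0, 0, le_rfl, MemLp.zero, ?_, ?_, ?_, ?_⟩ <;> simp [← hκ]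
  set κ := ∫ x, f x ^ 2 ∂μ
  have hε : 0 < η ^ 2 * κ := by positivity
  obtain ⟨g₀, hg₀, -⟩ := MemLp.exists_boundedContinuous_integral_rpow_sub_le (p := 2) (by norm_num)
    (by simpa using hf) hε
  have hb4 : MemLp g₀ 4 μ := by
    refine MemLp.of_bound g₀.continuous.aestronglyMeasurable ‖g₀‖ (ae_of_all _ fun x => ?_)
    exact g₀.norm_coe_le_norm x
  set c := ∫ x, g₀ x ∂μ
  have hg4 : MemLp (fun x => g₀ x - c) 4 μ := hb4.sub (memLp_const c)
  have hgm : ∫ x, (g₀ x - c) ∂μ = 0 := by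
    rw [integral_sub hb4.two_of_four.one_of_two (integrable_const _)]
    simp [c]
  have hd : MemLp (fun x => f x - g₀ x) 2 μ := hf.sub hb4.two_of_four
  have hdm : ∫ x, (f x - g₀ x) ∂μ = -c := by
    rw [integral_sub hf.one_of_two hb4.two_of_four.one_of_two, h0, zero_sub]
  have hdist : ∫ x, (f x - (g₀ x - c)) ^ 2 ∂μ ≤ η ^ 2 * κ := by
    have e : ∀ x, (f x - (g₀ x - c)) ^ 2 = (f x - g₀ x) ^ 2 + (2 * c) * (f x - g₀ x) + c ^ 2 :=
      fun x => by ring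
    simp_rw [e]
    rw [integral_add_three hd.integrable_sq (hd.one_of_two.const_mul _) (integrable_const _),
      integral_const_mul, hdm]
    have : ∫ x, (f x - g₀ x) ^ 2 ∂μ ≤ η ^ 2 * κ := by
      simpa [Real.norm_eq_abs, sq_abs] using hg₀
    simp only [integral_const, probReal_univ, one_smul]
    nlinarith [sq_nonneg c]
  refine ⟨fun x => g₀ x - c, (∫ x, (g₀ x - c) ^ 4 ∂μ) / κ ^ 2, ?_, hg4, hgm, hdist, ?_, ?_⟩
  · exact div_nonneg (integral_nonneg fun x => by positivity) (by positivity)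
  · have hr : MemLp (fun x => f x - (g₀ x - c)) 2 μ := hf.sub hg4.two_of_four
    have hfr : Integrable (fun x => f x * (f x - (g₀ x - c))) μ := hf.integrable_mul hr
    have e : ∀ x, (g₀ x - c) ^ 2 = (f x - (g₀ x - c)) ^ 2 + (-2) * (f x * (f x - (g₀ x - c)))
        + f x ^ 2 := fun x => by ring
    have hs : √(∫ x, (f x - (g₀ x - c)) ^ 2 ∂μ) ≤ η * √κ := by
      rw [Real.sqrt_le_iff]
      refine ⟨by positivity, ?_⟩
      rw [mul_pow, Real.sq_sqrt hκ0]
      exact hdist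
    have c1 := integral_mul_le_sqrt_mul_sqrt hf hr
    have c2 := integral_mul_le_sqrt_mul_sqrt hf.neg hr
    simp only [Pi.neg_apply, neg_mul, integral_neg, neg_sq] at c2
    have c3 : √κ * √(∫ x, (f x - (g₀ x - c)) ^ 2 ∂μ) ≤ η * κ := by
      calc _ ≤ √κ * (η * √κ) := by gcongr
        _ = η * (√κ * √κ) := by ring
        _ = _ := by rw [Real.mul_self_sqrt hκ0]
    have c4 : 0 ≤ ∫ x, (f x - (g₀ x - c)) ^ 2 ∂μ := integral_nonneg fun x => sq_nonneg _
    have c5 : η ^ 2 * κ ≤ η * κ := by nlinarith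
    have hval : ∫ x, (g₀ x - c) ^ 2 ∂μ = ∫ x, (f x - (g₀ x - c)) ^ 2 ∂μ +
        (-2) * ∫ x, f x * (f x - (g₀ x - c)) ∂μ + κ := by
      rw [integral_congr_ae (ae_of_all _ e), integral_add_three hr.integrable_sq
        (hfr.const_mul _) hf.integrable_sq, integral_const_mul]
    rw [hval, abs_le]
    constructor <;> linarith
  · rw [div_mul_cancel₀]
    positivity

/-- Centred integrable functions can be approximated in `L¹` by centred square-integrable
functions. -/
lemma exists_memLp_two_approx {f : ℝ → ℝ} (hf : Integrable f μ) (h0 : ∫ x, f x ∂μ = 0) {ε : ℝ}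
    (hε : 0 < ε) :
    ∃ h : ℝ → ℝ, MemLp h 2 μ ∧ ∫ x, h x ∂μ = 0 ∧ ∫ x, |f x - h x| ∂μ ≤ ε := by
  obtain ⟨h₀, hh₀, -⟩ := hf.exists_boundedContinuous_integral_sub_le (half_pos hε)
  have hb : MemLp h₀ 2 μ := by
    refine MemLp.of_bound h₀.continuous.aestronglyMeasurable ‖h₀‖ (ae_of_all _ fun x => ?_)
    exact h₀.norm_coe_le_norm x
  set c := ∫ x, h₀ x ∂μ
  have hd : Integrable (fun x => f x - h₀ x) μ := hf.sub hb.one_of_two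
  have hdm : ∫ x, (f x - h₀ x) ∂μ = -c := by
    rw [integral_sub hf hb.one_of_two, h0, zero_sub]
  have hc : |c| ≤ ε / 2 := by
    rw [← abs_neg, ← hdm]
    exact (abs_integral_le_integral_abs).trans hh₀
  refine ⟨fun x => h₀ x - c, hb.sub (memLp_const c), ?_, ?_⟩
  · rw [integral_sub hb.one_of_two (integrable_const _)]
    simp [c]
  · calc ∫ x, |f x - (h₀ x - c)| ∂μ ≤ ∫ x, (|f x - h₀ x| + |c|) ∂μ := by
          refine integral_mono (hf.sub (hb.one_of_two.sub (integrable_const c))).abs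
            (hd.abs.add (integrable_const _)) fun x => ?_
          have : f x - (h₀ x - c) = (f x - h₀ x) + c := by ring
          simp only [this]
          exact abs_add_le _ _
      _ = ∫ x, |f x - h₀ x| ∂μ + |c| := by
          rw [integral_add hd.abs (integrable_const _)]
          simp
      _ ≤ ε := by
          have : ∫ x, |f x - h₀ x| ∂μ ≤ ε / 2 := hh₀
          linarith

end Approximation

/-! ### Decomposition of the statistic, its mean, and a rate for the martingale part -/

section Decomposition

lemma trSq_eq {n p : ℕ} (z : Fin n → Fin p → ℝ) :
    trSq z = (1 / (n : ℝ)) ^ 2 * (∑ i, (∑ t, z t i ^ 2) ^ 2 + gramSq z) := by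
  have h1 : ∀ i j, (∑ t, Matrix.vecMulVec (z t) (z t)) i j = ∑ t, z t i * z t j := by
    intro i j
    simp [Matrix.sum_apply, Matrix.vecMulVec_apply]
  have h2 : ∀ i, ∑ j, (∑ t, z t i * z t j) * (∑ t, z t j * z t i) =
      (∑ t, z t i ^ 2) ^ 2 + ∑ j, gramOff z i j ^ 2 := by
    intro i
    have h3 : ∀ j, (∑ t, z t i * z t j) * (∑ t, z t j * z t i) =
        (if i = j then (∑ t, z t i ^ 2) ^ 2 else 0) + gramOff z i j ^ 2 := by
      intro j
      unfold gramOff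
      split_ifs with h
      · subst h; simp [sq]
      · simp only [mul_comm (z _ j)]; ring
    simp only [h3, Finset.sum_add_distrib, Finset.sum_ite_eq, Finset.mem_univ, if_true]
  simp only [trSq, sampleCov, smul_pow, Matrix.trace_smul, smul_eq_mul]
  congr 1
  simp only [sq (∑ t, Matrix.vecMulVec (z t) (z t)), Matrix.trace, Matrix.diag_apply,
    Matrix.mul_apply, h1, h2, Finset.sum_add_distrib, gramSq]

/-- The statistic minus its mean, decomposed into centred sums. Only
`entrySum (x² - 1)` and `crossSum` matter asymptotically. -/
lemma trSq_sub_muCLT {n p : ℕ} (hn : 0 < n) (m : ℝ) (z : Fin n → Fin p → ℝ) :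
    (n : ℝ) ^ 2 * (trSq z - muCLT n p m) =
      2 * ((n : ℝ) + p - 2) * entrySum (fun x => x ^ 2 - 1) z + crossSum z
        + entrySum (fun x => x ^ 4 - m) z + colPairs (fun x => x ^ 2 - 1) z
        + rowPairs (fun x => x ^ 2 - 1) z := by
  have hn' : (n : ℝ) ≠ 0 := by exact_mod_cast hn.ne'
  have hcross : crossSum z = gramSq z - colPairs (fun x => x ^ 2 - 1) z
      - 2 * ((p : ℝ) - 1) * entrySum (fun x => x ^ 2 - 1) z - n * (p * (p - 1)) := by
    simp only [crossSum, colPairs, entrySum, quadForm_sq_offDiag, Finset.sum_add_distrib,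
      ← Finset.mul_sum, Finset.sum_const, Finset.card_univ, Fintype.card_fin, nsmul_eq_mul]
    ring
  have hrow : rowPairs (fun x => x ^ 2 - 1) z =
      ∑ i, ((∑ t, z t i ^ 2 - n) ^ 2 - ∑ t, (z t i ^ 2 - 1) ^ 2) := by
    unfold rowPairs
    refine Finset.sum_congr rfl fun i _ => ?_
    rw [quadForm_offDiag]
    simp
  have hcomm : ∀ f : ℝ → ℝ, entrySum f z = ∑ i, ∑ t, f (z t i) := fun f => Finset.sum_comm
  have hmain : ∑ i, (∑ t, z t i ^ 2) ^ 2 =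
      2 * ((n : ℝ) - 1) * entrySum (fun x => x ^ 2 - 1) z + entrySum (fun x => x ^ 4 - m) z
        + rowPairs (fun x => x ^ 2 - 1) z + p * (n ^ 2 - n + n * m) := by
    rw [hrow, hcomm, hcomm, Finset.mul_sum, ← Finset.sum_add_distrib, ← Finset.sum_add_distrib]
    have : (p : ℝ) * (n ^ 2 - n + n * m) = ∑ _i : Fin p, ((n : ℝ) ^ 2 - n + n * m) := by
      rw [Finset.sum_const, Finset.card_univ, Fintype.card_fin, nsmul_eq_mul]
    rw [this, ← Finset.sum_add_distrib]
    refine Finset.sum_congr rfl fun i _ => ?_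
    simp only [sub_sq, Finset.sum_sub_distrib, Finset.sum_add_distrib, Finset.sum_const,
      Finset.card_univ, Fintype.card_fin, nsmul_eq_mul, ← pow_mul, mul_one, ← Finset.mul_sum]
    ring
  rw [trSq_eq, muCLT, hmain, hcross]
  field_simp
  ring

end Decomposition

section Mean

variable {μ : Measure ℝ} [IsProbabilityMeasure μ] {n p : ℕ}

lemma integrable_pow_four_sub (hx : MemLp (fun x : ℝ => x) 4 μ) :
    Integrable (fun x => x ^ 4 - ∫ y, y ^ 4 ∂μ) μ :=
  hx.integrable_pow_four.sub (integrable_const _)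

lemma integral_pow_four_sub (hx : MemLp (fun x : ℝ => x) 4 μ) :
    ∫ x, (x ^ 4 - ∫ y, y ^ 4 ∂μ) ∂μ = 0 := by
  rw [integral_sub hx.integrable_pow_four (integrable_const _)]
  simp

lemma integrable_entrySum {f : ℝ → ℝ} (hf : Integrable f μ) :
    Integrable (entrySum f) (sampleLaw μ n p) :=
  memLp_one_iff_integrable.1 (memLp_entrySum (memLp_one_iff_integrable.2 hf))

lemma integrable_trSq_sub (hx : MemLp (fun x : ℝ => x) 4 μ) (h1 : ∫ x, x ∂μ = 0)
    (h2 : ∫ x, x ^ 2 ∂μ = 1) (hn : 0 < n) :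
    Integrable (fun z : Fin n → Fin p → ℝ => trSq z - muCLT n p (∫ x, x ^ 4 ∂μ))
      (sampleLaw μ n p) ∧
    ∫ z : Fin n → Fin p → ℝ, (trSq z - muCLT n p (∫ x, x ^ 4 ∂μ)) ∂(sampleLaw μ n p) = 0 := by
  have hn' : (n : ℝ) ≠ 0 := by exact_mod_cast hn.ne'
  have hy := memLp_sq_sub_one hx
  have hy0 := integral_sq_sub_one hx h2
  have i1 : Integrable (fun z : Fin n → Fin p → ℝ =>
      2 * ((n : ℝ) + p - 2) * entrySum (fun x => x ^ 2 - 1) z) (sampleLaw μ n p) :=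
    (integrable_entrySum hy.one_of_two).const_mul _
  have i2 : Integrable (crossSum : (Fin n → Fin p → ℝ) → ℝ) (sampleLaw μ n p) :=
    (memLp_crossSum hx).one_of_two
  have i3 : Integrable (entrySum (fun x => x ^ 4 - ∫ y, y ^ 4 ∂μ) : (Fin n → Fin p → ℝ) → ℝ)
    (sampleLaw μ n p) := integrable_entrySum (integrable_pow_four_sub hx)
  have i4 : Integrable (colPairs (fun x => x ^ 2 - 1) : (Fin n → Fin p → ℝ) → ℝ)
    (sampleLaw μ n p) := (memLp_colPairs hy).one_of_two
  have i5 : Integrable (rowPairs (fun x => x ^ 2 - 1) : (Fin n → Fin p → ℝ) → ℝ)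
    (sampleLaw μ n p) := (memLp_rowPairs hy).one_of_two
  have i1234 : Integrable (fun z : Fin n → Fin p → ℝ =>
      2 * ((n : ℝ) + p - 2) * entrySum (fun x => x ^ 2 - 1) z + crossSum z
        + entrySum (fun x => x ^ 4 - ∫ y, y ^ 4 ∂μ) z + colPairs (fun x => x ^ 2 - 1) z)
      (sampleLaw μ n p) := ((i1.add i2).add i3).add i4
  have e : ∀ z : Fin n → Fin p → ℝ, trSq z - muCLT n p (∫ x, x ^ 4 ∂μ) = ((n : ℝ) ^ 2)⁻¹ *
      (2 * ((n : ℝ) + p - 2) * entrySum (fun x => x ^ 2 - 1) z + crossSum z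
        + entrySum (fun x => x ^ 4 - ∫ y, y ^ 4 ∂μ) z + colPairs (fun x => x ^ 2 - 1) z
        + rowPairs (fun x => x ^ 2 - 1) z) := by
    intro z
    rw [← trSq_sub_muCLT hn, ← mul_assoc, inv_mul_cancel₀ (by positivity), one_mul]
  simp_rw [e]
  refine ⟨(i1234.add i5).const_mul _, ?_⟩
  rw [integral_const_mul, integral_add i1234 i5, integral_add_four i1 i2 i3 i4,
    integral_const_mul, integral_entrySum hy.one_of_two hy0, integral_crossSum hx h1 h2,
    integral_entrySum (integrable_pow_four_sub hx) (integral_pow_four_sub hx),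
    integral_colPairs hy hy0, integral_rowPairs hy hy0]
  simp

end Mean

section Quantitative

lemma gramVar_le {μ : Measure ℝ} {n p : ℕ} (hn : 0 < n) (hp : 0 < p) {κ : ℝ} (hκ : ∫ x, (x ^ 2 - 1) ^ 2 ∂μ = κ) :
    gramVar μ n p ≤ (n : ℝ) ^ 2 * (p : ℝ) ^ 3 * (16 + 8 * κ ^ 2 + 16 * κ) := by
  have hκ0 : 0 ≤ κ := hκ ▸ integral_nonneg fun x => sq_nonneg _
  have hn1 : (1 : ℝ) ≤ n := by exact_mod_cast hn
  have hp1 : (1 : ℝ) ≤ p := by exact_mod_cast hp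
  have a1 : (p : ℝ) ^ 2 ≤ p ^ 3 := pow_le_pow_right₀ hp1 (by norm_num)
  have a2 : (n : ℝ) ≤ n ^ 2 := by nlinarith
  have b1 : (n : ℝ) ^ 2 * p ^ 2 ≤ n ^ 2 * p ^ 3 := by gcongr
  have b2 : (n : ℝ) * p ^ 2 ≤ n ^ 2 * p ^ 3 := by gcongr
  have b3 : (n : ℝ) * p ^ 3 ≤ n ^ 2 * p ^ 3 := by gcongr
  have c2 := mul_le_mul_of_nonneg_left b2 (sq_nonneg κ)
  have c3 := mul_le_mul_of_nonneg_left b3 hκ0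
  rw [gramVar, hκ]
  nlinarith

variable {μ : Measure ℝ} [IsProbabilityMeasure μ] {n p : ℕ} {g : ℝ → ℝ}

/-- The characteristic function of `mart` under the normalization relevant here is close to a
Gaussian one, with a rate in `n` and `p` and constants depending only on moments. -/
lemma norm_charFun_mart_sub_le (hx : MemLp (fun x : ℝ => x) 4 μ) (h1 : ∫ x, x ∂μ = 0)
    (h2 : ∫ x, x ^ 2 ∂μ = 1) (hg : MemLp g 4 μ) (hg0 : ∫ x, g x ∂μ = 0) {κ B : ℝ}
    (hκ : ∫ x, (x ^ 2 - 1) ^ 2 ∂μ = κ) (hB : 0 ≤ B) (hg2 : ∫ x, g x ^ 2 ∂μ ≤ 4 * κ)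
    (hg4 : ∫ x, g x ^ 4 ∂μ ≤ B * κ ^ 2) (hn : 0 < n) (hp : 0 < p) {α β : ℝ} (u : ℝ)
    (hα : α ^ 2 * (n * p) * κ ≤ 1) (hβ : β ^ 2 * (4 * n ^ 2 * p ^ 2) ≤ 1) :
    ‖∫ z : Fin n → Fin p → ℝ, Complex.exp ((u * mart g α β z : ℝ) * Complex.I)
        ∂(sampleLaw μ n p)
      - Real.exp (-(u ^ 2 * (∑ k ∈ Finset.range n, incrVar μ g α β k p) / 2))‖ ≤
      u ^ 2 * √(16 + 8 * κ ^ 2 + 16 * κ) / √p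
        + (12 * |u| ^ 3 + 2 * |u| ^ 3 * (32 * B + 2048 * (∫ x, x ^ 4 ∂μ) ^ 2 *
            (17 + 8 * κ ^ 2 + 16 * κ)) + 9 * u ^ 4) / √n := by
  have hκ0 : 0 ≤ κ := hκ ▸ integral_nonneg fun x => sq_nonneg _
  have hn1 : (1 : ℝ) ≤ n := by exact_mod_cast hn
  have hp1 : (1 : ℝ) ≤ p := by exact_mod_cast hp
  have hn0 : (0 : ℝ) < n := by linarith
  have hp0 : (0 : ℝ) < p := by linarith
  set m := ∫ x, x ^ 4 ∂μ
  set K := 16 + 8 * κ ^ 2 + 16 * κ with hK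
  have hK0 : 0 ≤ K := by positivity
  set r := √(n : ℝ) with hr
  have hr2 : r ^ 2 = n := Real.sq_sqrt hn0.le
  have hr1 : 1 ≤ r := Real.one_le_sqrt.2 hn1
  have hr0 : 0 < r := by linarith
  have hβ' : β ^ 2 ≤ 1 / (4 * n ^ 2 * p ^ 2) := by
    rw [le_div_iff₀ (by positivity)]; exact hβ
  have hακ : α ^ 2 * p * κ ≤ 1 / n := by
    rw [le_div_iff₀ hn0]; linarith
  have hstep : ∀ k < n, ‖(∫ z : Fin (k + 1) → Fin p → ℝ,
        Complex.exp ((u * mart g α β z : ℝ) * Complex.I) ∂(sampleLaw μ (k + 1) p))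
      - Real.exp (-(u ^ 2 * incrVar μ g α β k p / 2)) *
        ∫ z : Fin k → Fin p → ℝ, Complex.exp ((u * mart g α β z : ℝ) * Complex.I)
          ∂(sampleLaw μ k p)‖ ≤
      u ^ 2 * √K / √p / n + 2 * |u| ^ 3 * (r⁻¹ * (6 / n) + (32 * B + 2048 * m ^ 2 * (K + 1))
        * r / n ^ 2) + u ^ 4 * (6 / n) ^ 2 / 4 := by
    intro k hk
    have hkn : (k : ℝ) ≤ n := by exact_mod_cast hk.le
    refine (norm_charFun_mart_succ_sub_le hx h1 h2 hg hg0 α β u (inv_pos.2 hr0)).trans ?_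
    have hG : gramVar μ k p ≤ (n : ℝ) ^ 2 * (p : ℝ) ^ 3 * K :=
      (gramVar_mono μ hk.le p).trans (gramVar_le hn hp hκ)
    have hv : incrVar μ g α β k p ≤ 6 / n := by
      have a1 : α ^ 2 * p * (∫ x, g x ^ 2 ∂μ) ≤ 4 / n := by
        calc _ ≤ α ^ 2 * p * (4 * κ) := by gcongr
          _ = 4 * (α ^ 2 * p * κ) := by ring
          _ ≤ 4 * (1 / n) := by gcongr
          _ = _ := by ring
      have a2 : 8 * β ^ 2 * (k * (p * (p - 1))) ≤ 2 / n := by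
        calc _ ≤ 8 * (1 / (4 * (n : ℝ) ^ 2 * p ^ 2)) * (n * p ^ 2) := by
              have := natCast_mul_sub_one_nonneg p
              have : (p : ℝ) * (p - 1) ≤ p ^ 2 := by nlinarith
              gcongr
          _ = _ := by field_simp; norm_num
      unfold incrVar
      calc _ ≤ 4 / (n : ℝ) + 2 / n := add_le_add a1 a2
        _ = _ := by ring
    have hv0 := incrVar_nonneg μ g k p α β
    have t1 : 4 * u ^ 2 * β ^ 2 * √(gramVar μ k p) ≤ u ^ 2 * √K / √p / n := by
      have s1 : √(gramVar μ k p) ≤ n * p ^ 2 * (√K / √p) := by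
        rw [Real.sqrt_le_iff]
        refine ⟨by positivity, hG.trans (le_of_eq ?_)⟩
        rw [mul_pow, div_pow, Real.sq_sqrt hK0, Real.sq_sqrt hp0.le]
        field_simp
      calc _ ≤ 4 * u ^ 2 * (1 / (4 * (n : ℝ) ^ 2 * p ^ 2)) * (n * p ^ 2 * (√K / √p)) := by
            gcongr
        _ = _ := by field_simp
    have t2 : 32 * α ^ 4 * p ^ 2 * (∫ x, g x ^ 4 ∂μ) ≤ 32 * B / n ^ 2 := by
      calc _ ≤ 32 * α ^ 4 * p ^ 2 * (B * κ ^ 2) := by gcongr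
        _ = 32 * B * (α ^ 2 * p * κ) ^ 2 := by ring
        _ ≤ 32 * B * (1 / n) ^ 2 := by gcongr
        _ = _ := by ring
    have t3 : 32768 * β ^ 4 * m ^ 2 * (gramVar μ k p + (k : ℝ) ^ 2 * (p : ℝ) ^ 4) ≤
        2048 * m ^ 2 * (K + 1) / n ^ 2 := by
      have s1 : gramVar μ k p + (k : ℝ) ^ 2 * (p : ℝ) ^ 4 ≤ n ^ 2 * p ^ 4 * (K + 1) := by
        have : (n : ℝ) ^ 2 * (p : ℝ) ^ 3 * K ≤ (n : ℝ) ^ 2 * (p : ℝ) ^ 4 * K := by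
          gcongr 2
          exact pow_le_pow_right₀ hp1 (by norm_num)
        have : (k : ℝ) ^ 2 * (p : ℝ) ^ 4 ≤ (n : ℝ) ^ 2 * (p : ℝ) ^ 4 := by gcongr
        linarith
      calc _ = 32768 * (β ^ 2) ^ 2 * m ^ 2 * (gramVar μ k p + (k : ℝ) ^ 2 * (p : ℝ) ^ 4) := by
            ring
        _ ≤ 32768 * (1 / (4 * (n : ℝ) ^ 2 * p ^ 2)) ^ 2 * m ^ 2 * (n ^ 2 * p ^ 4 * (K + 1)) := by
            have := gramVar_nonneg μ k p
            gcongr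
        _ = _ := by field_simp; ring
    have t4 : (32 * α ^ 4 * p ^ 2 * (∫ x, g x ^ 4 ∂μ) + 32768 * β ^ 4 * m ^ 2 *
        (gramVar μ k p + (k : ℝ) ^ 2 * (p : ℝ) ^ 4)) / r⁻¹ ≤
        (32 * B + 2048 * m ^ 2 * (K + 1)) * r / n ^ 2 := by
      calc _ ≤ (32 * B / n ^ 2 + 2048 * m ^ 2 * (K + 1) / n ^ 2) / r⁻¹ := by gcongr
        _ = _ := by field_simp
    gcongr
  have := norm_sub_exp_le_of_step (Φ := fun k => ∫ z : Fin k → Fin p → ℝ,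
    Complex.exp ((u * mart g α β z : ℝ) * Complex.I) ∂(sampleLaw μ k p))
    (v := fun k => incrVar μ g α β k p)
    (by simp [mart, entrySum, crossSum, gramSq, gramOff])
    (fun k => incrVar_nonneg μ g k p α β) hstep
  refine this.trans ?_
  have e : (n : ℝ) * (u ^ 2 * √K / √p / n + 2 * |u| ^ 3 * (r⁻¹ * (6 / n)
      + (32 * B + 2048 * m ^ 2 * (K + 1)) * r / n ^ 2) + u ^ 4 * (6 / n) ^ 2 / 4) =
      u ^ 2 * √K / √p + (12 * |u| ^ 3 + 2 * |u| ^ 3 * (32 * B + 2048 * m ^ 2 * (K + 1))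
        + 9 * u ^ 4 / r) / r := by
    rw [← hr2]
    field_simp
    ring
  rw [e]
  have e2 : (17 + 8 * κ ^ 2 + 16 * κ) = K + 1 := by rw [hK]; ring
  rw [e2]
  have : 9 * u ^ 4 / r ≤ 9 * u ^ 4 := div_le_self (by positivity) hr1
  gcongr

end Quantitative

/-! ### Distance between the statistic and the martingale -/

section Comparison

variable {μ : Measure ℝ} [IsProbabilityMeasure μ] {n p : ℕ} {g h : ℝ → ℝ}

lemma integral_sq_sub_one_sq (hx : MemLp (fun x : ℝ => x) 4 μ) (h2 : ∫ x, x ^ 2 ∂μ = 1) :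
    ∫ x, (x ^ 2 - 1) ^ 2 ∂μ = ∫ x, x ^ 4 ∂μ - 1 := by
  have e : ∀ x : ℝ, (x ^ 2 - 1) ^ 2 = x ^ 4 + (-2) * x ^ 2 + 1 := fun x => by ring
  simp_rw [e]
  rw [integral_add_three hx.integrable_pow_four (hx.two_of_four.integrable_sq.const_mul _)
    (integrable_const _), integral_const_mul, h2]
  simp
  ring

lemma integral_abs_entrySum_le_sqrt {f : ℝ → ℝ} (hf : MemLp f 2 μ) (h0 : ∫ x, f x ∂μ = 0) :
    ∫ z, |entrySum f z| ∂(sampleLaw μ n p) ≤ √(n * p) * √(∫ x, f x ^ 2 ∂μ) := by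
  refine (integral_abs_le_sqrt (memLp_entrySum hf)).trans (le_of_eq ?_)
  rw [integral_entrySum_sq hf h0, Real.sqrt_mul (by positivity)]

lemma entrySum_sub (f₁ f₂ : ℝ → ℝ) (z : Fin n → Fin p → ℝ) :
    entrySum (fun x => f₁ x - f₂ x) z = entrySum f₁ z - entrySum f₂ z := by
  simp [entrySum, Finset.sum_sub_distrib]

/-- The `L¹` distance between the standardized statistic and the martingale `mart`, in which
`x² - 1` is replaced by `g`; `h` is an auxiliary square-integrable approximation of `x⁴ - E x⁴`. -/
lemma integral_abs_stat_sub_mart_le (hx : MemLp (fun x : ℝ => x) 4 μ)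
    (h2 : ∫ x, x ^ 2 ∂μ = 1) (hg : MemLp g 4 μ) (hg0 : ∫ x, g x ∂μ = 0)
    (hh : MemLp h 2 μ) (hh0 : ∫ x, h x ∂μ = 0) {κ η ε s : ℝ}
    (hκ : ∫ x, (x ^ 2 - 1) ^ 2 ∂μ = κ) (hη : 0 ≤ η)
    (hgη : ∫ x, (x ^ 2 - 1 - g x) ^ 2 ∂μ ≤ η ^ 2 * κ)
    (hhε : ∫ x, |x ^ 4 - (∫ y, y ^ 4 ∂μ) - h x| ∂μ ≤ ε) (hn : 0 < n) (hp : 0 < p)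
    (hs : 0 < s) (hs2 : s ^ 2 = 4 * κ * (n * p) * (n + p) ^ 2 + 4 * n ^ 2 * p ^ 2) :
    ∫ z : Fin n → Fin p → ℝ, |(n : ℝ) ^ 2 * (trSq z - muCLT n p (∫ x, x ^ 4 ∂μ)) / s
        - mart g (2 * (n + p) / s) (1 / s) z| ∂(sampleLaw μ n p) ≤
      η + ε / 2 + (2 * √κ + √(∫ x, h x ^ 2 ∂μ) + κ) / √n + κ / √p := by
  have hκ0 : 0 ≤ κ := hκ ▸ integral_nonneg fun x => sq_nonneg _
  have hn1 : (1 : ℝ) ≤ n := by exact_mod_cast hn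
  have hp1 : (1 : ℝ) ≤ p := by exact_mod_cast hp
  have hn0 : (0 : ℝ) < n := by linarith
  have hp0 : (0 : ℝ) < p := by linarith
  have hε0 : 0 ≤ ε := (integral_nonneg fun x => abs_nonneg _).trans hhε
  have hs1 : 2 * (n * p) ≤ s := by
    refine (sq_le_sq₀ (by positivity) hs.le).1 ?_
    rw [hs2]
    have : 0 ≤ 4 * κ * (n * p) * ((n : ℝ) + p) ^ 2 := by positivity
    nlinarith
  have hy := memLp_sq_sub_one hx
  have hy0 := integral_sq_sub_one hx h2
  have hyg : MemLp (fun x => x ^ 2 - 1 - g x) 2 μ := hy.sub hg.two_of_four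
  have hyg0 : ∫ x, (x ^ 2 - 1 - g x) ∂μ = 0 := by
    rw [integral_sub hy.one_of_two hg.two_of_four.one_of_two, hy0, hg0, sub_zero]
  have hH := integrable_pow_four_sub hx
  have hHh : Integrable (fun x => x ^ 4 - (∫ y, y ^ 4 ∂μ) - h x) μ := hH.sub hh.one_of_two
  -- the error terms
  have i1 : Integrable (fun z : Fin n → Fin p → ℝ => 2 * ((n : ℝ) + p) / s *
      |entrySum (fun x => x ^ 2 - 1 - g x) z|) (sampleLaw μ n p) :=
    (integrable_entrySum hyg.one_of_two).abs.const_mul _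
  have i2 : Integrable (fun z : Fin n → Fin p → ℝ => 4 / s *
      |entrySum (fun x => x ^ 2 - 1) z|) (sampleLaw μ n p) :=
    (integrable_entrySum hy.one_of_two).abs.const_mul _
  have i3 : Integrable (fun z : Fin n → Fin p → ℝ => 1 / s *
      |entrySum (fun x => x ^ 4 - (∫ y, y ^ 4 ∂μ) - h x) z|) (sampleLaw μ n p) :=
    (integrable_entrySum hHh).abs.const_mul _
  have i4 : Integrable (fun z : Fin n → Fin p → ℝ => 1 / s * |entrySum h z|)
      (sampleLaw μ n p) := (integrable_entrySum hh.one_of_two).abs.const_mul _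
  have i5 : Integrable (fun z : Fin n → Fin p → ℝ => 1 / s *
      |colPairs (fun x => x ^ 2 - 1) z|) (sampleLaw μ n p) :=
    (memLp_colPairs hy).one_of_two.abs.const_mul _
  have i6 : Integrable (fun z : Fin n → Fin p → ℝ => 1 / s *
      |rowPairs (fun x => x ^ 2 - 1) z|) (sampleLaw μ n p) :=
    (memLp_rowPairs hy).one_of_two.abs.const_mul _
  set N := √((n : ℝ) * p) with hN
  have hN2 : N ^ 2 = n * p := Real.sq_sqrt (by positivity)
  have hN0 : 0 < N := Real.sqrt_pos.2 (by positivity)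
  have hNn : √n ≤ N := Real.sqrt_le_sqrt (by nlinarith)
  have hrn : 0 < √(n : ℝ) := Real.sqrt_pos.2 hn0
  have hrp : 0 < √(p : ℝ) := Real.sqrt_pos.2 hp0
  have hsinv : 1 / s ≤ 1 / (2 * N ^ 2) := by
    rw [hN2]; exact one_div_le_one_div_of_le (by positivity) hs1
  have hNs : N / s ≤ 1 / (2 * √n) := by
    calc N / s = N * (1 / s) := by ring
      _ ≤ N * (1 / (2 * N ^ 2)) := by gcongr
      _ = 1 / (2 * N) := by field_simp
      _ ≤ _ := by gcongr
  have b1 : ∫ z : Fin n → Fin p → ℝ, 2 * ((n : ℝ) + p) / s *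
      |entrySum (fun x => x ^ 2 - 1 - g x) z| ∂(sampleLaw μ n p) ≤ η := by
    rw [integral_const_mul]
    have h1 : √(∫ x, (x ^ 2 - 1 - g x) ^ 2 ∂μ) ≤ η * √κ := by
      rw [Real.sqrt_le_iff]
      refine ⟨by positivity, hgη.trans (le_of_eq ?_)⟩
      rw [mul_pow, Real.sq_sqrt hκ0]
    have h3 : 2 * ((n : ℝ) + p) * N * √κ ≤ s := by
      refine (sq_le_sq₀ (by positivity) hs.le).1 ?_
      rw [hs2, mul_pow, mul_pow, mul_pow, Real.sq_sqrt hκ0, hN2]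
      have : (0 : ℝ) ≤ 4 * n ^ 2 * p ^ 2 := by positivity
      linarith
    calc _ ≤ 2 * ((n : ℝ) + p) / s * (N * (η * √κ)) := by
          gcongr
          exact (integral_abs_entrySum_le_sqrt hyg hyg0).trans (by gcongr)
      _ = η * (2 * ((n : ℝ) + p) * N * √κ / s) := by ring
      _ ≤ η * 1 := by
          gcongr
          exact (div_le_one hs).2 h3
      _ = η := mul_one _
  have b2 : ∫ z : Fin n → Fin p → ℝ, 4 / s * |entrySum (fun x => x ^ 2 - 1) z|
      ∂(sampleLaw μ n p) ≤ 2 * √κ / √n := by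
    rw [integral_const_mul]
    have := integral_abs_entrySum_le_sqrt (n := n) (p := p) hy hy0
    rw [hκ] at this
    calc _ ≤ 4 / s * (N * √κ) := by gcongr
      _ = 4 * √κ * (N / s) := by ring
      _ ≤ 4 * √κ * (1 / (2 * √n)) := by gcongr
      _ = _ := by field_simp; ring
  have b3 : ∫ z : Fin n → Fin p → ℝ, 1 / s *
      |entrySum (fun x => x ^ 4 - (∫ y, y ^ 4 ∂μ) - h x) z| ∂(sampleLaw μ n p) ≤ ε / 2 := by
    rw [integral_const_mul]
    calc _ ≤ 1 / (2 * N ^ 2) * (n * p * ε) := by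
          gcongr
          exact (integral_abs_entrySum_le hHh).trans (by gcongr)
      _ = _ := by rw [hN2]; field_simp
  have b4 : ∫ z : Fin n → Fin p → ℝ, 1 / s * |entrySum h z| ∂(sampleLaw μ n p) ≤
      √(∫ x, h x ^ 2 ∂μ) / √n := by
    rw [integral_const_mul]
    calc _ ≤ 1 / s * (N * √(∫ x, h x ^ 2 ∂μ)) := by
          gcongr
          exact integral_abs_entrySum_le_sqrt hh hh0
      _ = √(∫ x, h x ^ 2 ∂μ) * (N / s) := by ring
      _ ≤ √(∫ x, h x ^ 2 ∂μ) * (1 / √n) :=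
          mul_le_mul_of_nonneg_left (hNs.trans (one_div_le_one_div_of_le hrn (by linarith)))
            (Real.sqrt_nonneg _)
      _ = _ := by ring
  have b5 : ∫ z : Fin n → Fin p → ℝ, 1 / s * |colPairs (fun x => x ^ 2 - 1) z|
      ∂(sampleLaw μ n p) ≤ κ / √n := by
    rw [integral_const_mul]
    have h1 : ∫ z : Fin n → Fin p → ℝ, |colPairs (fun x => x ^ 2 - 1) z| ∂(sampleLaw μ n p) ≤
        2 * √n * p * κ := by
      refine (integral_abs_le_sqrt (memLp_colPairs hy)).trans ?_
      rw [Real.sqrt_le_iff]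
      refine ⟨by positivity, (integral_colPairs_sq_le hy hy0).trans ?_⟩
      rw [hκ, mul_pow, mul_pow, mul_pow, Real.sq_sqrt hn0.le]
      have : 0 ≤ (n : ℝ) * p ^ 2 * κ ^ 2 := by positivity
      linarith
    calc _ ≤ 1 / (2 * N ^ 2) * (2 * √n * p * κ) := by
          gcongr
      _ = κ * (√n / n) := by rw [hN2]; field_simp
      _ = _ := by rw [Real.sqrt_div_self']; ring
  have b6 : ∫ z : Fin n → Fin p → ℝ, 1 / s * |rowPairs (fun x => x ^ 2 - 1) z|
      ∂(sampleLaw μ n p) ≤ κ / √p := by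
    rw [integral_const_mul]
    have h1 : ∫ z : Fin n → Fin p → ℝ, |rowPairs (fun x => x ^ 2 - 1) z| ∂(sampleLaw μ n p) ≤
        2 * n * √p * κ := by
      refine (integral_abs_le_sqrt (memLp_rowPairs hy)).trans ?_
      rw [Real.sqrt_le_iff]
      refine ⟨by positivity, (integral_rowPairs_sq_le hy hy0).trans ?_⟩
      rw [hκ, mul_pow, mul_pow, mul_pow, Real.sq_sqrt hp0.le]
      have : 0 ≤ (n : ℝ) ^ 2 * p * κ ^ 2 := by positivity
      linarith
    calc _ ≤ 1 / (2 * N ^ 2) * (2 * n * √p * κ) := by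
          gcongr
      _ = κ * (√p / p) := by rw [hN2]; field_simp
      _ = _ := by rw [Real.sqrt_div_self']; ring
  have i1234 : Integrable (fun z : Fin n → Fin p → ℝ =>
      2 * ((n : ℝ) + p) / s * |entrySum (fun x => x ^ 2 - 1 - g x) z|
        + 4 / s * |entrySum (fun x => x ^ 2 - 1) z|
        + 1 / s * |entrySum (fun x => x ^ 4 - (∫ y, y ^ 4 ∂μ) - h x) z|
        + 1 / s * |entrySum h z|) (sampleLaw μ n p) := ((i1.add i2).add i3).add i4
  have hle : ∀ z : Fin n → Fin p → ℝ,
      |(n : ℝ) ^ 2 * (trSq z - muCLT n p (∫ x, x ^ 4 ∂μ)) / s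
        - mart g (2 * (n + p) / s) (1 / s) z| ≤
      (2 * ((n : ℝ) + p) / s * |entrySum (fun x => x ^ 2 - 1 - g x) z|
        + 4 / s * |entrySum (fun x => x ^ 2 - 1) z|
        + 1 / s * |entrySum (fun x => x ^ 4 - (∫ y, y ^ 4 ∂μ) - h x) z|
        + 1 / s * |entrySum h z|)
        + 1 / s * |colPairs (fun x => x ^ 2 - 1) z|
        + 1 / s * |rowPairs (fun x => x ^ 2 - 1) z| := by
    intro z
    have e : (n : ℝ) ^ 2 * (trSq z - muCLT n p (∫ x, x ^ 4 ∂μ)) / s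
        - mart g (2 * (n + p) / s) (1 / s) z =
        2 * ((n : ℝ) + p) / s * entrySum (fun x => x ^ 2 - 1 - g x) z
        + -(4 / s * entrySum (fun x => x ^ 2 - 1) z)
        + 1 / s * entrySum (fun x => x ^ 4 - (∫ y, y ^ 4 ∂μ) - h x) z
        + 1 / s * entrySum h z
        + 1 / s * colPairs (fun x => x ^ 2 - 1) z
        + 1 / s * rowPairs (fun x => x ^ 2 - 1) z := by
      rw [trSq_sub_muCLT hn, mart, entrySum_sub (fun x => x ^ 2 - 1) g,
        entrySum_sub (fun x => x ^ 4 - ∫ y, y ^ 4 ∂μ) h]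
      ring
    have ha : ∀ c x : ℝ, 0 ≤ c → c * |x| = |c * x| := fun c x hc => by
      rw [abs_mul, abs_of_nonneg hc]
    rw [e, ha _ _ (by positivity), ha _ _ (by positivity), ha _ _ (by positivity),
      ha _ _ (by positivity), ha _ _ (by positivity), ha _ _ (by positivity),
      ← abs_neg (4 / s * _)]
    refine (abs_add_le _ _).trans (add_le_add ((abs_add_le _ _).trans (add_le_add
      ((abs_add_le _ _).trans (add_le_add ((abs_add_le _ _).trans (add_le_add
      (abs_add_le _ _) le_rfl)) le_rfl)) le_rfl)) le_rfl)
  have key := integral_mono_of_nonneg (μ := sampleLaw μ n p)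
    (ae_of_all _ fun z => abs_nonneg _) ((i1234.add i5).add i6) (ae_of_all _ hle)
  refine key.trans ?_
  have hsum : ∫ z : Fin n → Fin p → ℝ,
      ((2 * ((n : ℝ) + p) / s * |entrySum (fun x => x ^ 2 - 1 - g x) z|
        + 4 / s * |entrySum (fun x => x ^ 2 - 1) z|
        + 1 / s * |entrySum (fun x => x ^ 4 - (∫ y, y ^ 4 ∂μ) - h x) z|
        + 1 / s * |entrySum h z|)
        + 1 / s * |colPairs (fun x => x ^ 2 - 1) z|
        + 1 / s * |rowPairs (fun x => x ^ 2 - 1) z|) ∂(sampleLaw μ n p) ≤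
      (η + 2 * √κ / √n + ε / 2 + √(∫ x, h x ^ 2 ∂μ) / √n) + κ / √n + κ / √p := by
    rw [integral_add_three i1234 i5 i6]
    refine add_le_add (add_le_add ?_ b5) b6
    have := integral_add_four i1 i2 i3 i4
    rw [this]
    linarith
  refine hsum.trans (le_of_eq ?_)
  ring

end Comparison

/-! ### The limit -/

section Limit

lemma sq_mul_sigmaCLT {n p : ℕ} (hn : 0 < n) (hp : 0 < p) {κ : ℝ} (hκ : 0 ≤ κ) :
    0 < (n : ℝ) ^ 2 * sigmaCLT n p (κ + 1) ∧ ((n : ℝ) ^ 2 * sigmaCLT n p (κ + 1)) ^ 2 =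
      4 * κ * (n * p) * (n + p) ^ 2 + 4 * n ^ 2 * p ^ 2 := by
  have hn0 : (0 : ℝ) < n := by exact_mod_cast hn
  have hp0 : (0 : ℝ) < p := by exact_mod_cast hp
  have hσ : sigmaSqCLT n p (κ + 1) =
      (4 * κ * (n * p) * (n + p) ^ 2 + 4 * n ^ 2 * p ^ 2) / n ^ 4 := by
    unfold sigmaSqCLT
    field_simp
    ring
  have hpos : 0 < sigmaSqCLT n p (κ + 1) := by rw [hσ]; positivity
  refine ⟨mul_pos (by positivity) (Real.sqrt_pos.2 hpos), ?_⟩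
  rw [mul_pow, sigmaCLT, Real.sq_sqrt hpos.le, hσ]
  field_simp

lemma abs_sum_incrVar_sub_one_le {μ : Measure ℝ} {n p : ℕ} {g : ℝ → ℝ} {κ η s : ℝ} (hκ : 0 ≤ κ)
    (hη : |∫ x, g x ^ 2 ∂μ - κ| ≤ 3 * η * κ) (hη0 : 0 ≤ η) (hn : 0 < n) (hp : 0 < p) (hs : 0 < s)
    (hs2 : s ^ 2 = 4 * κ * (n * p) * (n + p) ^ 2 + 4 * n ^ 2 * p ^ 2) :
    |∑ k ∈ Finset.range n, incrVar μ g (2 * (n + p) / s) (1 / s) k p - 1| ≤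
      3 * η + 1 / n + 1 / p := by
  have hn1 : (1 : ℝ) ≤ n := by exact_mod_cast hn
  have hp1 : (1 : ℝ) ≤ p := by exact_mod_cast hp
  have hn0 : (0 : ℝ) < n := by linarith
  have hp0 : (0 : ℝ) < p := by linarith
  have e : ∑ k ∈ Finset.range n, incrVar μ g (2 * (n + p) / s) (1 / s) k p - 1 =
      (4 * (n * p) * (n + p) ^ 2 * (∫ x, g x ^ 2 ∂μ - κ)
        + -(4 * (n * p) * (n + p - 1))) / s ^ 2 := by
    rw [sum_incrVar, eq_div_iff (by positivity)]
    have : (1 : ℝ) * s ^ 2 = 4 * κ * (n * p) * (n + p) ^ 2 + 4 * n ^ 2 * p ^ 2 := by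
      rw [one_mul, hs2]
    rw [sub_mul, this]
    field_simp
    ring
  rw [e, abs_div, abs_of_nonneg (sq_nonneg s), div_le_iff₀ (by positivity)]
  refine (abs_add_le _ _).trans ?_
  rw [abs_neg, abs_mul, abs_of_nonneg (by positivity : (0 : ℝ) ≤ 4 * (n * p) * (n + p) ^ 2),
    abs_of_nonneg (mul_nonneg (by positivity) (by linarith) :
      (0 : ℝ) ≤ 4 * (n * p) * (n + p - 1)), hs2]
  have a1 := mul_le_mul_of_nonneg_left hη
    (by positivity : (0 : ℝ) ≤ 4 * (n * p) * ((n : ℝ) + p) ^ 2)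
  have a2 : (1 / (n : ℝ) + 1 / p) * (4 * n ^ 2 * p ^ 2) = 4 * (n * p) * (n + p) := by
    field_simp
    ring
  have a3 : 0 ≤ (1 / (n : ℝ) + 1 / p) * (4 * κ * (n * p) * (n + p) ^ 2) := by positivity
  have a4 : 0 ≤ 3 * η * (4 * n ^ 2 * p ^ 2) := by positivity
  have a5 : (0 : ℝ) ≤ 4 * (n * p) := by positivity
  nlinarith

variable {μ : Measure ℝ} [IsProbabilityMeasure μ]

/-- The central limit theorem for the law of a sample, in terms of characteristic functions. -/
lemma tendsto_charFun_stat (hx : MemLp (fun x : ℝ => x) 4 μ) (h1 : ∫ x, x ∂μ = 0)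
    (h2 : ∫ x, x ^ 2 ∂μ = 1) {p : ℕ → ℕ} (hp : Tendsto p atTop atTop) (u : ℝ) :
    Tendsto (fun n => ∫ z : Fin n → Fin (p n) → ℝ, Complex.exp
      ((u * ((trSq z - muCLT n (p n) (∫ x, x ^ 4 ∂μ)) / sigmaCLT n (p n) (∫ x, x ^ 4 ∂μ)) : ℝ)
        * Complex.I) ∂(sampleLaw μ n (p n))) atTop (nhds (Real.exp (-(u ^ 2 / 2)) : ℂ)) := by
  set κ := ∫ x, (x ^ 2 - 1) ^ 2 ∂μ with hκ
  have hκ0 : 0 ≤ κ := integral_nonneg fun x => sq_nonneg _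
  have hm : ∫ x, x ^ 4 ∂μ = κ + 1 := by rw [hκ, integral_sq_sub_one_sq hx h2]; ring
  rw [Metric.tendsto_atTop']
  intro ε hε
  -- the size of the truncation errors is chosen first, then `n` is taken large
  set c := 3 / 2 * |u| + 3 / 2 * u ^ 2 with hc
  have hc0 : 0 ≤ c := by positivity
  set η := min 1 (ε / (2 * (c + 1))) with hηd
  have hη0 : 0 < η := by positivity
  have hη1 : η ≤ 1 := min_le_left _ _
  have hcη : c * η < ε := by
    calc c * η ≤ c * (ε / (2 * (c + 1))) := by gcongr; exact min_le_right _ _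
      _ = ε * (c / (2 * (c + 1))) := by ring
      _ < ε * 1 := by
          gcongr
          rw [div_lt_one (by positivity)]
          linarith
      _ = ε := mul_one _
  obtain ⟨g, B, hB, hg, hg0, hgη, hgκ, hg4⟩ :=
    exists_memLp_four_approx (memLp_sq_sub_one hx) (integral_sq_sub_one hx h2) hη0 hη1
  obtain ⟨h, hh, hh0, hhη⟩ := exists_memLp_two_approx (integrable_pow_four_sub hx)
    (integral_pow_four_sub hx) hη0
  rw [← hκ] at hgη hgκ hg4
  have hg2 : ∫ x, g x ^ 2 ∂μ ≤ 4 * κ := by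
    have := (abs_le.1 hgκ).2
    nlinarith
  set C₁ := 2 * √κ + √(∫ x, h x ^ 2 ∂μ) + κ
  set C₂ := u ^ 2 * √(16 + 8 * κ ^ 2 + 16 * κ)
  set C₃ := 12 * |u| ^ 3 + 2 * |u| ^ 3 * (32 * B + 2048 * (∫ x, x ^ 4 ∂μ) ^ 2 *
            (17 + 8 * κ ^ 2 + 16 * κ)) + 9 * u ^ 4
  let F : ℕ → ℝ := fun n => |u| * (η + η / 2 + C₁ / √n + κ / √(p n))
    + (C₂ / √(p n) + C₃ / √n) + u ^ 2 / 2 * (3 * η + 1 / n + 1 / (p n))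
  have hF : Tendsto F atTop (nhds (c * η)) := by
    have l1 : Tendsto (fun n : ℕ => (n : ℝ)) atTop atTop := tendsto_natCast_atTop_atTop
    have l2 : Tendsto (fun n : ℕ => √(n : ℝ)) atTop atTop := Real.tendsto_sqrt_atTop.comp l1
    have l3 : Tendsto (fun n : ℕ => (p n : ℝ)) atTop atTop := l1.comp hp
    have l4 : Tendsto (fun n : ℕ => √(p n : ℝ)) atTop atTop := l2.comp hp
    have t := (((((tendsto_const_nhds (x := η + η / 2)).add (l2.const_div_atTop C₁)).add
      (l4.const_div_atTop κ)).const_mul |u|).add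
      ((l4.const_div_atTop C₂).add (l2.const_div_atTop C₃))).add
      ((((tendsto_const_nhds (x := 3 * η)).add (l1.const_div_atTop 1)).add
        (l3.const_div_atTop 1)).const_mul (u ^ 2 / 2))
    convert t using 2
    rw [hc]; ring
  have hev := (hF.eventually (gt_mem_nhds hcη)).and
    ((eventually_gt_atTop 0).and (hp.eventually (eventually_gt_atTop 0)))
  obtain ⟨n₀, hn₀⟩ := eventually_atTop.1 hev
  refine ⟨n₀, fun n hn => ?_⟩
  obtain ⟨hFn, hnpos, hppos⟩ := hn₀ n hn.le
  refine lt_of_le_of_lt ?_ hFn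
  obtain ⟨hs, hs2⟩ := sq_mul_sigmaCLT hnpos hppos hκ0
  rw [← hm] at hs hs2
  set s := (n : ℝ) ^ 2 * sigmaCLT n (p n) (∫ x, x ^ 4 ∂μ) with hsdef
  have hn0 : (0 : ℝ) < n := by exact_mod_cast hnpos
  have hp0 : (0 : ℝ) < p n := by exact_mod_cast hppos
  have hstat : ∀ z : Fin n → Fin (p n) → ℝ,
      (trSq z - muCLT n (p n) (∫ x, x ^ 4 ∂μ)) / sigmaCLT n (p n) (∫ x, x ^ 4 ∂μ) =
      (n : ℝ) ^ 2 * (trSq z - muCLT n (p n) (∫ x, x ^ 4 ∂μ)) / s := fun z => by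
    rw [hsdef, mul_div_mul_left _ _ (by positivity)]
  simp_rw [hstat]
  have b1 := integral_abs_stat_sub_mart_le hx h2 hg hg0 hh hh0 hκ.symm hη0.le hgη hhη hnpos hppos
    hs hs2
  have b2 := norm_charFun_mart_sub_le (α := 2 * (n + p n) / s) (β := 1 / s) hx h1 h2 hg hg0
    hκ.symm hB hg2 hg4 hnpos hppos u
    (by
      have e : (2 * ((n : ℝ) + p n) / s) ^ 2 * (n * p n) * κ =
        (4 * κ * (n * p n) * (n + p n) ^ 2) / s ^ 2 := by ring
      rw [e, div_le_one (by positivity), hs2]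
      have : (0 : ℝ) ≤ 4 * n ^ 2 * p n ^ 2 := by positivity
      linarith)
    (by
      have e : (1 / s) ^ 2 * (4 * (n : ℝ) ^ 2 * p n ^ 2) = (4 * n ^ 2 * p n ^ 2) / s ^ 2 := by ring
      rw [e, div_le_one (by positivity), hs2]
      have : (0 : ℝ) ≤ 4 * κ * (n * p n) * (n + p n) ^ 2 := by positivity
      linarith)
  have b3 := abs_sum_incrVar_sub_one_le hκ0 hgκ hη0.le hnpos hppos hs hs2
  set V := ∑ k ∈ Finset.range n, incrVar μ g (2 * (n + p n) / s) (1 / s) k (p n)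
  have hV0 : 0 ≤ V := Finset.sum_nonneg fun k _ => incrVar_nonneg μ g k (p n) _ _
  have b4 : ‖(Real.exp (-(u ^ 2 * V / 2)) : ℂ) - (Real.exp (-(u ^ 2 / 2)) : ℂ)‖ ≤
      u ^ 2 / 2 * (3 * η + 1 / n + 1 / (p n)) := by
    rw [← Complex.ofReal_sub, Complex.norm_real, Real.norm_eq_abs]
    refine (abs_exp_neg_sub_exp_neg_le (by positivity) (by positivity)).trans ?_
    have e : u ^ 2 * V / 2 - u ^ 2 / 2 = u ^ 2 / 2 * (V - 1) := by ring
    rw [e, abs_mul, abs_of_nonneg (by positivity : 0 ≤ u ^ 2 / 2)]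
    gcongr
  have hstatI : Integrable (fun z : Fin n → Fin (p n) → ℝ =>
      u * ((n : ℝ) ^ 2 * (trSq z - muCLT n (p n) (∫ x, x ^ 4 ∂μ)) / s)) (sampleLaw μ n (p n)) :=
    (((integrable_trSq_sub hx h1 h2 hnpos).1.const_mul _).div_const _).const_mul _
  have hmartI : Integrable (fun z : Fin n → Fin (p n) → ℝ =>
      u * mart g (2 * (n + p n) / s) (1 / s) z) (sampleLaw μ n (p n)) :=
    (memLp_mart hx hg _ _).one_of_two.const_mul _
  have b5 := norm_integral_exp_sub_le hstatI hmartI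
  simp only [← mul_sub, abs_mul u] at b5
  rw [integral_const_mul] at b5
  rw [dist_eq_norm]
  have b6 := b5.trans (mul_le_mul_of_nonneg_left b1 (abs_nonneg u))
  refine (norm_sub_le_norm_sub_add_norm_sub _ _ _).trans
    (add_le_add ((norm_sub_le_norm_sub_add_norm_sub _ _ _).trans (add_le_add b6 b2)) b4)

end Limit

section Transfer

/-- A family of independent variables with common law, indexed by observation and coordinate, has
law `sampleLaw`. -/
lemma map_sample_eq {Ω Ω₀ : Type*} [MeasurableSpace Ω] [MeasurableSpace Ω₀] {P : Measure Ω}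
    [IsProbabilityMeasure P] {P₀ : Measure Ω₀} {X : Ω₀ → ℝ} {n p : ℕ} {x : Ω → Fin n → Fin p → ℝ}
    [IsProbabilityMeasure (P₀.map X)]
    (hindep : iIndepFun (fun (q : Fin n × Fin p) ω => x ω q.1 q.2) P)
    (hident : ∀ t i, IdentDistrib (fun ω => x ω t i) X P P₀) :
    P.map x = sampleLaw (P₀.map X) n p := by
  have hm : ∀ q : Fin n × Fin p, AEMeasurable (fun ω => x ω q.1 q.2) P :=
    fun q => (hident q.1 q.2).aemeasurable_fst
  have h := (iIndepFun_iff_map_fun_eq_pi_map hm).1 hindep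
  simp only [fun q : Fin n × Fin p => (hident q.1 q.2).map_eq] at h
  have hc := Measure.infinitePi_map_curry (fun (_ : Fin n) (_ : Fin p) => P₀.map X)
  simp only [Measure.infinitePi_eq_pi] at hc
  rw [← h, AEMeasurable.map_map_of_aemeasurable (MeasurableEquiv.measurable _).aemeasurable
    (aemeasurable_pi_lambda _ hm)] at hc
  exact hc

lemma measurable_trSq (n p : ℕ) : Measurable (trSq : (Fin n → Fin p → ℝ) → ℝ) := by
  have : (trSq : (Fin n → Fin p → ℝ) → ℝ) =
      fun z => (1 / (n : ℝ)) ^ 2 * (∑ i, (∑ t, z t i ^ 2) ^ 2 + gramSq z) := funext trSq_eq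
  rw [this]
  refine Measurable.const_mul (Measurable.add (by fun_prop) ?_) _
  refine Finset.measurable_sum _ fun i _ => Finset.measurable_sum _ fun j _ => ?_
  unfold gramOff
  split_ifs <;> fun_prop

end Transfer

theorem theorem2p2
    -- the generic random variable `X`: mean zero, variance one, finite fourth moment
    {Ω₀ : Type*} [MeasurableSpace Ω₀] (P₀ : Measure Ω₀) [IsProbabilityMeasure P₀]
    (X : Ω₀ → ℝ) (hXmeas : AEMeasurable X P₀)
    (hXmean : ∫ ω, X ω ∂P₀ = 0) (hXvar : ∫ ω, X ω ^ 2 ∂P₀ = 1)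
    (hX4 : Integrable (fun ω => X ω ^ 4) P₀)
    -- the dimensions
    (p : ℕ → ℕ) (hp : Tendsto p atTop atTop)
    -- for each `n`, a sample of size `n` of `p n`-dimensional vectors whose coordinates are all
    -- independent copies of `X`
    {Ω : ℕ → Type*} [∀ n, MeasurableSpace (Ω n)] (P : ∀ n, Measure (Ω n))
    [∀ n, IsProbabilityMeasure (P n)]
    (x : ∀ n, Ω n → Fin n → Fin (p n) → ℝ)
    (hindep : ∀ n, iIndepFun (fun (q : Fin n × Fin (p n)) (ω : Ω n) => x n ω q.1 q.2) (P n))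
    (hident : ∀ n (t : Fin n) (i : Fin (p n)),
      IdentDistrib (fun ω => x n ω t i) X (P n) P₀)
    -- a standard normal random variable `Z`
    {Ω' : Type*} [MeasurableSpace Ω'] (P' : Measure Ω') [IsProbabilityMeasure P']
    (Z : Ω' → ℝ) (hZ : HasLaw Z (gaussianReal 0 1) P') :
    (∀ n, 0 < n → Integrable (fun ω => trSq (x n ω)) (P n) ∧
      ∫ ω, trSq (x n ω) ∂(P n) = muCLT n (p n) (∫ ω, X ω ^ 4 ∂P₀)) ∧
    TendstoInDistribution
      (fun n ω => (trSq (x n ω) - muCLT n (p n) (∫ ω₀, X ω₀ ^ 4 ∂P₀))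
        / sigmaCLT n (p n) (∫ ω₀, X ω₀ ^ 4 ∂P₀))
      atTop Z P P' := by
  have : IsProbabilityMeasure (P₀.map X) := Measure.isProbabilityMeasure_map hXmeas
  have h1 : ∫ y, y ∂(P₀.map X) = 0 := by
    rw [integral_map hXmeas (by fun_prop)]; exact hXmean
  have h2 : ∫ y, y ^ 2 ∂(P₀.map X) = 1 := by
    rw [integral_map hXmeas (by fun_prop)]; exact hXvar
  have h4 : ∫ y, y ^ 4 ∂(P₀.map X) = ∫ ω, X ω ^ 4 ∂P₀ := integral_map hXmeas (by fun_prop)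
  have hx : MemLp (fun y : ℝ => y) 4 (P₀.map X) :=
    memLp_four_of_integrable (by fun_prop)
      ((integrable_map_measure (by fun_prop) hXmeas).2 hX4)
  have hxm : ∀ n, AEMeasurable (x n) (P n) := fun n =>
    aemeasurable_pi_lambda _ fun t => aemeasurable_pi_lambda _ fun i =>
      (hident n t i).aemeasurable_fst
  have hlaw : ∀ n, (P n).map (x n) = sampleLaw (P₀.map X) n (p n) := fun n =>
    map_sample_eq (hindep n) (hident n)
  have hstat : ∀ n, Measurable fun z : Fin n → Fin (p n) → ℝ =>
      (trSq z - muCLT n (p n) (∫ ω₀, X ω₀ ^ 4 ∂P₀)) / sigmaCLT n (p n) (∫ ω₀, X ω₀ ^ 4 ∂P₀) :=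
    fun n => ((measurable_trSq n (p n)).sub_const _).div_const _
  refine ⟨fun n hn => ?_, ?_⟩
  · obtain ⟨hi, hm⟩ := integrable_trSq_sub (p := p n) hx h1 h2 hn
    have hint : Integrable (trSq : (Fin n → Fin (p n) → ℝ) → ℝ) (sampleLaw (P₀.map X) n (p n)) := by
      refine (hi.add (integrable_const (muCLT n (p n) (∫ y, y ^ 4 ∂(P₀.map X))))).congr
        (ae_of_all _ fun z => ?_)
      simp
    rw [integral_sub hint (integrable_const _), h4] at hm
    simp only [integral_const, probReal_univ, one_smul] at hm
    rw [← hlaw n] at hint hm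
    refine ⟨hint.comp_aemeasurable (hxm n), ?_⟩
    rw [integral_map (hxm n) (measurable_trSq n (p n)).aestronglyMeasurable] at hm
    linarith
  · refine ⟨fun n => (hstat n).comp_aemeasurable (hxm n), hZ.aemeasurable, ?_⟩
    refine ProbabilityMeasure.tendsto_iff_tendsto_charFun.2 fun u => ?_
    have hlim := tendsto_charFun_stat hx h1 h2 hp u
    rw [h4] at hlim
    have hgauss : charFun (P'.map Z) u = (Real.exp (-(u ^ 2 / 2)) : ℂ) := by
      rw [hZ.map_eq, charFun_gaussianReal]
      push_cast
      congr 1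
      simp
    simp only [ProbabilityMeasure.coe_mk]
    rw [hgauss]
    refine hlim.congr fun n => ?_
    have hmap := AEMeasurable.map_map_of_aemeasurable (hstat n).aemeasurable (hxm n)
    rw [hlaw n] at hmap
    rw [charFun_apply_real]
    simp only [Function.comp_def] at hmap
    rw [← hmap]
    rw [integral_map (hstat n).aemeasurable (by fun_prop)]
    simp
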